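/- Consider $n\ge 2$ photons entering the first $n$ modes, one per mode, of an $m$-mode linear interferometer ($m\ge n$) with unitary matrix $U$, so that the creation operators evolve as $a^\dagger_j\mapsto\sum_k U_{jk}b^\dagger_k$ and internal states are unchanged. The photons may be partially distinguishable: the photon in mode $j$ has an arbitrary unit vector $\phi_j$ as internal state, and $S_{ij}=\langle\phi_i|\phi_j\rangle$ is their Gram matrix. Let $\mathcal K_1,\dots,\mathcal K_K$ be pairwise disjoint sets (bins) of output modes, and for $k\in\{0,\dots,n\}^K$ let $P(k)$ be the probability of finding exactly $k_z$ photons in $\mathcal K_z$ for every $z$. For every number $K$ of bins and every failure probability $\delta>0$ there are a constant $C$ and one randomized classical algorithm (a random access machine with exact complex arithmetic and fair coins, unit cost per instruction), depending only on $K$ and $\delta$, such that for all $n$, $m$, $U$, $\mathcal K_1,\dots,\mathcal K_K$, $\phi_1,\dots,\phi_n$ as above and all $0<\beta\le 1$ the algorithm outputs, with probability at least $1-\delta$, real numbers $\tilde P(k)$, $k\in\{0,\dots,n\}^K$, with $$\sum_{k}|\tilde P(k)-P(k)|\le\beta .$$ The algorithm has two phases. A preparatory phase sees only $n$, $m$,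 $U$ and the bins, and takes at most $C\,m\,n^2$ steps. The main phase continues from the memory left by it, receives $S$, $\beta$ and the number $e^{2\pi i/(n+1)}$, and takes at most $C\,n^{2K+2}\log(n)\,\beta^{-2}$ steps. Both time bounds hold for all outcomes of the coins. The same algorithm with the same bounds covers loss: it works for a lossy interferometer that consists of an $m$-mode interferometer $W_1$, a loss channel of arbitrary transmissivity $\lambda_i\in[0,1]$ in each mode $i$, and an $m$-mode interferometer $W_2$, with the bins among the $m$ measured modes. Its input is then the unitary matrix of the lossless $2m$-mode interferometer in which each loss channel is a beam splitter coupling mode $i$ to an initially empty, unmeasured environment mode. -/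

import Mathlib

open MeasureTheory
open scoped ComplexConjugate

universe u v

noncomputable section

namespace BosonSampling

/-! ### Photons in a linear interferometer -/

/-- State vectors of the bosonic Fock space over the set `M` of single-particle modes with finitely
many nonzero amplitudes: `Ψ N` is the amplitude of the normalized occupation-number state `|N⟩`. -/
abbrev Fock (M : Type*) : Type _ := (M →₀ ℕ) →₀ ℂ

/-- The vacuum `|0⟩`. -/
def vacuum (M : Type*) : Fock M := Finsupp.single 0 1

open Classical in
/-- The creation operator of mode `i`, that is `|N⟩ ↦ √(N i + 1) |N + e_i⟩`. -/
def creation {M : Type*} (i : M) : Module.End ℂ (Fock M) :=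
  Finsupp.lsum ℂ fun N : M →₀ ℕ =>
    LinearMap.toSpanSingleton ℂ (Fock M)
      (Finsupp.single (N + Finsupp.single i 1) ((Real.sqrt (N i + 1) : ℝ) : ℂ))

/-- The creation operator of a photon in spatial mode `k` and internal state `ψ`, written in the
orthonormal internal basis `Φ`. -/
def creationIn {E ι : Type*} [NormedAddCommGroup E] [InnerProductSpace ℂ E] [Fintype ι] {m : ℕ}
    (Φ : ι → E) (k : Fin m) (ψ : E) : Module.End ℂ (Fock (Fin m × ι)) :=
  ∑ a, (inner ℂ (Φ a) ψ) • creation (k, a)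

/-- The output state. One photon with internal state `φ j` enters each of the first `n` spatial
modes, and the interferometer replaces the creation operator of input mode `j` by
`∑ k, U j k` times the creation operator of output mode `k`, with the same internal state. -/
def outputState {E ι : Type*} [NormedAddCommGroup E] [InnerProductSpace ℂ E] [Fintype ι]
    {n m : ℕ} (h : n ≤ m) (U : Matrix (Fin m) (Fin m) ℂ) (φ : Fin n → E) (Φ : ι → E) :
    Fock (Fin m × ι) :=
  (List.ofFn fun j : Fin n => ∑ k, U (Fin.castLE h j) k • creationIn Φ k (φ j)).prod
    (vacuum (Fin m × ι))

/-- The number of photons, whatever their internal state, in a set of spatial modes. -/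
def photonsIn {ι : Type*} [Fintype ι] {m : ℕ} (A : Finset (Fin m)) (N : Fin m × ι →₀ ℕ) : ℕ :=
  ∑ j ∈ A, ∑ a, N (j, a)

open Classical in
/-- The probability of finding exactly `k z` photons in bin `𝒦 z` for every `z`. -/
def binnedProb {E ι : Type*} [NormedAddCommGroup E] [InnerProductSpace ℂ E] [Fintype ι]
    {n m K : ℕ} (h : n ≤ m) (U : Matrix (Fin m) (Fin m) ℂ) (φ : Fin n → E) (Φ : ι → E)
    (𝒦 : Fin K → Finset (Fin m)) (k : Fin K → ℕ) : ℝ :=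
  ∑ N ∈ (outputState h U φ Φ).support with ∀ z, photonsIn (𝒦 z) N = k z,
    ‖outputState h U φ Φ N‖ ^ 2

/-- The Gram matrix of the internal states. -/
def gram {E : Type*} [NormedAddCommGroup E] [InnerProductSpace ℂ E] {n : ℕ} (φ : Fin n → E) :
    Matrix (Fin n) (Fin n) ℂ :=
  Matrix.of fun i j => inner ℂ (φ i) (φ j)

/-- The lossless interferometer on `2 m` modes that describes a lossy one on `m` modes: first the
interferometer `W₁`, then for each `i` a beam splitter of transmissivity `lam i` that couples mode
`i` to an environment mode (initially empty), then the interferometer `W₂`. The environment modes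
are the last `m` modes. -/
def lossyUnitary {m : ℕ} (W₁ W₂ : Matrix (Fin m) (Fin m) ℂ) (lam : Fin m → ℝ) :
    Matrix (Fin (m + m)) (Fin (m + m)) ℂ :=
  let t : Matrix (Fin m) (Fin m) ℂ := Matrix.diagonal fun i => ((Real.sqrt (lam i) : ℝ) : ℂ)
  let r : Matrix (Fin m) (Fin m) ℂ := Matrix.diagonal fun i => ((Real.sqrt (1 - lam i) : ℝ) : ℂ)
  Matrix.reindex finSumFinEquiv finSumFinEquiv
    (Matrix.fromBlocks W₁ 0 0 1 * Matrix.fromBlocks t r (-r) t * Matrix.fromBlocks W₂ 0 0 1)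

/-! ### The machine model

A random access machine with exact complex arithmetic and fair coins. It has registers for natural
numbers (used as counters and addresses), registers for complex numbers, and finitely many arrays
of complex numbers. Each executed instruction costs one step. -/

/-- The names of the read-only input tables. -/
inductive Source
  | interferometer
  | bins
  | gram
  | accuracy
  | root

/-- Contents of the read-only input tables; a single number sits in row 0 and column 0. -/
abbrev Input : Type := Source → ℕ → ℕ → ℂ

/-- A configuration: natural-number registers, complex registers, arrays, the number of coins
used so far, and the number of steps made so far. -/
structure Config where
  nat : ℕ → ℕ
  num : ℕ → ℂ
  arr : ℕ → ℕ → ℂ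
  used : ℕ
  time : ℕ

/-- Programs. Natural-number registers are called `i j k`, complex registers `u v w`. -/
inductive Prog
  | skip
  | seq (p q : Prog)
  /-- Set register `i` to the constant `c`. -/
  | natConst (i c : ℕ)
  /-- `i := j + k`. -/
  | natAdd (i j k : ℕ)
  /-- `i := max (j - k) 0`. -/
  | natSub (i j k : ℕ)
  /-- Set register `u` to the integer constant `c`. -/
  | numConst (u : ℕ) (c : ℤ)
  /-- Copy the natural number in `i` to the complex register `u`. -/
  | numCast (u i : ℕ)
  | numAdd (u v w : ℕ)
  | numSub (u v w : ℕ)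
  | numMul (u v w : ℕ)
  | numDiv (u v w : ℕ)
  | numConj (u v : ℕ)
  /-- `u := A[i]`. -/
  | load (u A i : ℕ)
  /-- `A[i] := u`. -/
  | store (A i u : ℕ)
  /-- `u := T[i, j]` for the input table `T`. -/
  | read (u : ℕ) (T : Source) (i j : ℕ)
  /-- Count upwards in register `i` from zero until the real part of `u` is reached. -/
  | countTo (i u : ℕ)
  /-- Toss a fair coin and write 0 or 1 to register `i`. -/
  | toss (i : ℕ)
  /-- Run `p` if `i ≤ j`, and `q` otherwise. -/
  | ifNat (i j : ℕ) (p q : Prog)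
  /-- Run `p` if the real part of `u` is at most that of `v`, and `q` otherwise. -/
  | ifNum (u v : ℕ) (p q : Prog)
  /-- Run `p` as many times as register `i` says when the loop is entered. -/
  | loop (i : ℕ) (p : Prog)

namespace Config

def tick (t : ℕ) (s : Config) : Config := { s with time := s.time + t }

def setNat (s : Config) (i x : ℕ) : Config := { s with nat := Function.update s.nat i x }

def setNum (s : Config) (u : ℕ) (x : ℂ) : Config := { s with num := Function.update s.num u x }

def setArr (s : Config) (A i : ℕ) (x : ℂ) : Config :=
  { s with arr := Function.update s.arr A (Function.update (s.arr A) i x) }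

end Config

open Classical in
/-- The configuration in which a program ends, for given input tables, a given sequence of coin
tosses, and a given initial configuration. Counting up to `x` costs `⌈x⌉ + 1` steps, and each round
of a loop costs one step more than its body. -/
def Prog.exec (inp : Input) (coin : ℕ → Bool) : Prog → Config → Config
  | .skip, s => s
  | .seq p q, s => q.exec inp coin (p.exec inp coin s)
  | .natConst i c, s => (s.setNat i c).tick 1
  | .natAdd i j k, s => (s.setNat i (s.nat j + s.nat k)).tick 1
  | .natSub i j k, s => (s.setNat i (s.nat j - s.nat k)).tick 1
  | .numConst u c, s => (s.setNum u (c : ℂ)).tick 1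
  | .numCast u i, s => (s.setNum u (s.nat i : ℂ)).tick 1
  | .numAdd u v w, s => (s.setNum u (s.num v + s.num w)).tick 1
  | .numSub u v w, s => (s.setNum u (s.num v - s.num w)).tick 1
  | .numMul u v w, s => (s.setNum u (s.num v * s.num w)).tick 1
  | .numDiv u v w, s => (s.setNum u (s.num v / s.num w)).tick 1
  | .numConj u v, s => (s.setNum u (conj (s.num v))).tick 1
  | .load u A i, s => (s.setNum u (s.arr A (s.nat i))).tick 1
  | .store A i u, s => (s.setArr A (s.nat i) (s.num u)).tick 1
  | .read u T i j, s => (s.setNum u (inp T (s.nat i) (s.nat j))).tick 1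
  | .countTo i u, s => (s.setNat i ⌈(s.num u).re⌉₊).tick (⌈(s.num u).re⌉₊ + 1)
  | .toss i, s =>
    ({ s with used := s.used + 1 }.setNat i (if coin s.used then 1 else 0)).tick 1
  | .ifNat i j p q, s =>
    if s.nat i ≤ s.nat j then p.exec inp coin (s.tick 1) else q.exec inp coin (s.tick 1)
  | .ifNum u v p q, s =>
    if (s.num u).re ≤ (s.num v).re then p.exec inp coin (s.tick 1)
    else q.exec inp coin (s.tick 1)
  | .loop i p, s => (fun s' => p.exec inp coin (s'.tick 1))^[s.nat i] (s.tick 1)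

/-- The initial configuration: everything is zero, except that the natural-number registers 0
and 1 hold the number of photons and the number of modes. -/
def initial (n m : ℕ) : Config where
  nat := fun i => if i = 0 then n else if i = 1 then m else 0
  num := fun _ => 0
  arr := fun _ _ => 0
  used := 0
  time := 0

/-- The law of an infinite sequence of independent fair coin tosses. -/
def coinLaw : Measure (ℕ → Bool) :=
  Measure.infinitePi fun _ => (PMF.uniformOfFintype Bool).toMeasure

/-! ### Input and output of the algorithm -/

/-- A matrix as a table, filled up with zeros. -/
def table {a b : ℕ} (A : Matrix (Fin a) (Fin b) ℂ) (i j : ℕ) : ℂ :=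
  if h : i < a ∧ j < b then A ⟨i, h.1⟩ ⟨j, h.2⟩ else 0

open Classical in
/-- The description of the interferometer: its matrix, and the indicator functions of the bins
(the rows of the second table). -/
def opticsInput {K m : ℕ} (U : Matrix (Fin m) (Fin m) ℂ) (𝒦 : Fin K → Finset (Fin m)) : Input
  | .interferometer => table U
  | .bins => table (Matrix.of fun (z : Fin K) (j : Fin m) => if j ∈ 𝒦 z then (1 : ℂ) else 0)
  | _ => fun _ _ => 0

/-- The remaining data: the Gram matrix, the accuracy, and the root of unity `exp (2πi / (n + 1))`
that defines the Fourier grid. -/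
def modelInput {n : ℕ} (S : Matrix (Fin n) (Fin n) ℂ) (β : ℝ) : Input
  | .gram => table S
  | .accuracy => table (Matrix.of fun _ _ : Fin 1 => (β : ℂ))
  | .root => table (Matrix.of fun _ _ : Fin 1 => Complex.exp (2 * Real.pi * Complex.I / (n + 1)))
  | _ => fun _ _ => 0

/-- The configuration after the preparatory phase, which sees only the interferometer and the
bins. -/
def afterPrep {K m : ℕ} (n : ℕ) (prep : Prog) (U : Matrix (Fin m) (Fin m) ℂ)
    (𝒦 : Fin K → Finset (Fin m)) (coin : ℕ → Bool) : Config :=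
  prep.exec (opticsInput U 𝒦) coin (initial n m)

/-- The configuration after the main phase, which starts where the preparatory phase ended and
sees only the Gram matrix, the accuracy and the root of unity. -/
def afterMain {K m n : ℕ} (prep main : Prog) (U : Matrix (Fin m) (Fin m) ℂ)
    (𝒦 : Fin K → Finset (Fin m)) (S : Matrix (Fin n) (Fin n) ℂ) (β : ℝ) (coin : ℕ → Bool) :
    Config :=
  main.exec (modelInput S β) coin (afterPrep n prep U 𝒦 coin)

/-- The address in the output array, array 0, of the number assigned to `k`. -/
def address {K n : ℕ} (k : Fin K → Fin (n + 1)) : ℕ :=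
  ∑ z, (k z : ℕ) * (n + 1) ^ (z : ℕ)

/-- The final configuration `s` holds a table of real numbers whose `ℓ¹` distance from `P` on
`{0, …, n}^K` is at most `β`. -/
def OutputWithin {K : ℕ} (n : ℕ) (s : Config) (P : (Fin K → ℕ) → ℝ) (β : ℝ) : Prop :=
  ∃ Q : (Fin K → Fin (n + 1)) → ℝ,
    (∀ k, s.arr 0 (address k) = (Q k : ℂ)) ∧ ∑ k, |Q k - P fun z => (k z : ℕ)| ≤ β

end BosonSampling

end

open BosonSampling

/-!
The probabilities of the binned photon numbers are the Fourier coefficients of their characteristic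
function on the grid `{0, …, n} ^ K`. Its value at a grid point `a` is the permanent of the matrix
of scalar products `⟨v i, D v j⟩` (`sum_binnedProb_mul_prod_pow`). Here `v j` is the state, in the
space of spatial modes tensored with the internal space, in which photon `j` leaves the
interferometer, and `D` multiplies the modes of bin `z` by the phase `ω ^ a z`. The `v j` are
orthonormal because the interferometer is unitary, so the matrix is a contraction
(`sum_norm_sq_charMatrix_le`). For disjoint bins it is affine in the phases: its entries are
`δ i j + S i j * ∑ z, (ω ^ a z - 1) * H z i j`, where `H z` is the overlap matrix of bin `z`
(`charMatrix_apply`). The preparatory phase computes the matrices `H z`, which do not depend on the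
internal states.

The permanent of a contraction is the mean of Glynn's estimator, a random variable bounded by 1 that
costs `O(n ^ 2)` steps per sample (`sum_glynn`, `norm_glynn_le_one`). With `N` samples at each of
the `M = (n + 1) ^ K` grid points the expected sum of the squared errors is at most `M / N`, and this
needs independence of the samples for a fixed grid point only, so all grid points share the coins
(`sum_sum_norm_sq_le`). Taking real parts of the inverse Fourier transform of the estimates gives
the output. By Parseval and Cauchy–Schwarz its `ℓ¹` error is at most the square root of that sum
(`sum_norm_gridInv_le`). By Markov's inequality `N = ⌈c * M / β ^ 2⌉` samples with `c ≥ 1 / δ`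
suffice, which makes `O(n ^ 2 * M * N) = O(n ^ (2 * K + 2) * β⁻²)` steps; a Fourier transform by
direct summation fits into the same bound.

The programs are written in a small language of arithmetic expressions with bounded sums and
products, whose compilation to the machine is proved correct, with a bound on the running time, once
and for all (`NumExpr.correct`).

A lossy interferometer is covered because the matrix of its lossless extension is unitary
(`lossyUnitary_mem_unitaryGroup`); the doubled number of modes is absorbed in the constant.
-/

noncomputable section

namespace BosonSampling

/-! ### A small expression language for the machine -/

/-- `s'` arises from `s` by changing at most natural-number registers from `l` on, complex registers
from `d` on, and the clock. -/
structure Frame (l d : ℕ) (s s' : Config) : Prop where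
  nat : ∀ r < l, s'.nat r = s.nat r
  num : ∀ u < d, s'.num u = s.num u
  arr : s'.arr = s.arr
  used : s'.used = s.used

theorem Frame.refl (l d : ℕ) (s : Config) : Frame l d s s :=
  ⟨fun _ _ => rfl, fun _ _ => rfl, rfl, rfl⟩

theorem Frame.trans {l d : ℕ} {s s' s'' : Config} (h : Frame l d s s') (h' : Frame l d s' s'') :
    Frame l d s s'' :=
  ⟨fun r hr => (h'.nat r hr).trans (h.nat r hr), fun u hu => (h'.num u hu).trans (h.num u hu),
    h'.arr.trans h.arr, h'.used.trans h.used⟩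

theorem Frame.mono {l l' d d' : ℕ} {s s' : Config} (h : Frame l' d' s s') (hl : l ≤ l')
    (hd : d ≤ d') : Frame l d s s' :=
  ⟨fun r hr => h.nat r (hr.trans_le hl), fun u hu => h.num u (hu.trans_le hd), h.arr, h.used⟩

/-- A counting loop: run `p` with register `l` equal to `0, 1, …`, as often as register `r` says. -/
def forLoop (r l : ℕ) (p : Prog) : Prog :=
  .seq (.natConst l 0) (.loop r (.seq p (.seq (.natConst (l + 1) 1) (.natAdd l l (l + 1)))))

/-- The invariant rule for counting loops. The invariant must not depend on the registers from `l`
on, nor on the clock. -/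
theorem forLoop_spec {inp : Input} {coin : ℕ → Bool} {r l : ℕ} {p : Prog} {s : Config}
    (hr : r < l) (I : ℕ → Config → Prop) (T : ℕ → ℕ)
    (hI : ∀ i s s', I i s → (∀ r < l, s'.nat r = s.nat r) → s'.num = s.num → s'.arr = s.arr →
      s'.used = s.used → I i s')
    (h0 : I 0 s)
    (hbody : ∀ i < s.nat r, ∀ s', I i s' → s'.nat l = i → I (i + 1) (p.exec inp coin s') ∧
      (p.exec inp coin s').nat l = i ∧ (p.exec inp coin s').time ≤ s'.time + T i) :
    I (s.nat r) ((forLoop r l p).exec inp coin s) ∧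
      ((forLoop r l p).exec inp coin s).time
        ≤ s.time + (2 + ∑ i ∈ Finset.range (s.nat r), (T i + 3)) := by
  set f : Config → Config := fun s' => (Prog.seq p (.seq (.natConst (l + 1) 1)
    (.natAdd l l (l + 1)))).exec inp coin (s'.tick 1) with hf
  set s0 : Config := (((s.setNat l 0).tick 1).tick 1) with hs0
  have hexec : (forLoop r l p).exec inp coin s = f^[s.nat r] s0 := by
    simp [forLoop, Prog.exec, hf, hs0, Config.tick, Config.setNat, hr.ne]
  have key : ∀ N ≤ s.nat r, I N (f^[N] s0) ∧ (f^[N] s0).nat l = N ∧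
      (f^[N] s0).time ≤ s.time + (2 + ∑ i ∈ Finset.range N, (T i + 3)) := by
    intro N
    induction N with
    | zero =>
      intro _
      refine ⟨hI 0 s _ h0 ?_ ?_ ?_ ?_, ?_, ?_⟩
      · intro r' hr'
        simp [hs0, Config.tick, Config.setNat, hr'.ne]
      all_goals simp [hs0, Config.tick, Config.setNat]
    | succ N ih =>
      intro hN
      obtain ⟨h1, h2, h3⟩ := ih (by omega)
      rw [Function.iterate_succ_apply']
      set t := f^[N] s0
      have h1' : I N (t.tick 1) := hI _ _ _ h1 (by simp [Config.tick]) rfl rfl rfl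
      obtain ⟨b1, b2, b3⟩ := hbody N (by omega) (t.tick 1) h1' h2
      refine ⟨hI _ _ _ b1 ?_ ?_ ?_ ?_, ?_, ?_⟩
      · intro r' hr'
        have : r' ≠ l + 1 := by omega
        simp [hf, Prog.exec, Config.tick, Config.setNat, hr'.ne, this]
      · simp [hf, Prog.exec, Config.tick, Config.setNat]
      · simp [hf, Prog.exec, Config.tick, Config.setNat]
      · simp [hf, Prog.exec, Config.tick, Config.setNat]
      · simp [hf, Prog.exec, Config.tick, Config.setNat] at b2 ⊢
        exact b2
      · rw [Finset.sum_range_succ]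
        simp [hf, Prog.exec, Config.tick, Config.setNat] at b3 ⊢
        omega
  rw [hexec]
  exact ⟨(key _ le_rfl).1, (key _ le_rfl).2.2⟩

/-- Expressions for natural numbers, over registers. -/
inductive NatExpr
  | const (c : ℕ)
  | var (r : ℕ)
  | add (a b : NatExpr)
  | mul (a b : NatExpr)

namespace NatExpr

/-- The value, with respect to register contents `ρ`. -/
def eval (ρ : ℕ → ℕ) : NatExpr → ℕ
  | const c => c
  | var r => ρ r
  | add a b => a.eval ρ + b.eval ρ
  | mul a b => a.eval ρ * b.eval ρ

/-- Only registers below `l` occur. -/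
def Below (l : ℕ) : NatExpr → Prop
  | const _ => True
  | var r => r < l
  | add a b => a.Below l ∧ b.Below l
  | mul a b => a.Below l ∧ b.Below l

/-- The running time of the compiled expression. Multiplication is repeated addition, as often as
the left factor says. -/
def cost (ρ : ℕ → ℕ) : NatExpr → ℕ
  | const _ => 1
  | var _ => 2
  | add a b => a.cost ρ + b.cost ρ + 1
  | mul a b => a.cost ρ + b.cost ρ + (4 + 2 * a.eval ρ)

/-- The program that writes the value to register `l`, using registers from `l` on as workspace. -/
def compile : NatExpr → ℕ → Prog
  | const c, l => .natConst l c
  | var r, l => .seq (.natConst l 0) (.natAdd l r l)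
  | add a b, l => .seq (a.compile l) (.seq (b.compile (l + 1)) (.natAdd l l (l + 1)))
  | mul a b, l => .seq (a.compile l) (.seq (b.compile (l + 1)) (.seq (.natConst (l + 2) 0)
      (.seq (.loop l (.natAdd (l + 2) (l + 2) (l + 1)))
        (.seq (.natConst l 0) (.natAdd l l (l + 2))))))

theorem exec_loop_natAdd (inp : Input) (coin : ℕ → Bool) (l N : ℕ) (s : Config) :
    (fun s' => (Prog.natAdd (l + 2) (l + 2) (l + 1)).exec inp coin (s'.tick 1))^[N] s
      = (s.setNat (l + 2) (s.nat (l + 2) + N * s.nat (l + 1))).tick (2 * N) := by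
  induction N with
  | zero => simp [Config.setNat, Config.tick]
  | succ N ih =>
    rw [Function.iterate_succ_apply', ih]
    simp [Config.setNat, Config.tick, Prog.exec]
    constructor
    · congr 1; ring
    · ring

/-- Compiled expressions for natural numbers are correct. -/
theorem compile_spec (inp : Input) (coin : ℕ → Bool) {l₀ : ℕ} {ρ : ℕ → ℕ} (d : ℕ) (e : NatExpr)
    (he : e.Below l₀) : ∀ (l : ℕ) (s : Config), l₀ ≤ l → (∀ r < l₀, s.nat r = ρ r) →
      Frame l d s ((e.compile l).exec inp coin s) ∧
      ((e.compile l).exec inp coin s).nat l = e.eval ρ ∧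
      ((e.compile l).exec inp coin s).num = s.num ∧
      ((e.compile l).exec inp coin s).time ≤ s.time + e.cost ρ := by
  induction e with
  | const c =>
    intro l s _ hs
    refine ⟨⟨?_, ?_, ?_, ?_⟩, ?_, ?_, ?_⟩ <;>
      simp +contextual [compile, Prog.exec, Config.tick, Config.setNat, eval, cost, ne_of_lt]
  | var r =>
    intro l s hl hs
    have he' : r < l₀ := he
    have hrl : r ≠ l := by omega
    refine ⟨⟨?_, ?_, ?_, ?_⟩, ?_, ?_, ?_⟩ <;>
      simp +contextual [compile, Prog.exec, Config.tick, Config.setNat, eval, cost, ne_of_lt, hrl,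
        hs r he']
  | add a b iha ihb =>
    intro l s hl hs
    obtain ⟨fa, ea, na, ta⟩ := iha he.1 l s hl hs
    set s1 := (a.compile l).exec inp coin s
    obtain ⟨fb, eb, nb, tb⟩ := ihb he.2 (l + 1) s1 (by omega)
      fun r hr => (fa.nat r (by omega)).trans (hs r hr)
    have hl := fb.nat l (by omega)
    set s2 := (b.compile (l + 1)).exec inp coin s1
    have hex : ((add a b).compile l).exec inp coin s
        = (s2.setNat l (s2.nat l + s2.nat (l + 1))).tick 1 := rfl
    rw [hex]
    have f12 := fa.trans (fb.mono (Nat.le_succ l) le_rfl)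
    refine ⟨f12.trans ⟨?_, ?_, ?_, ?_⟩, ?_, ?_, ?_⟩
    · intro r hr; simp [Config.tick, Config.setNat, hr.ne]
    · intro u _; rfl
    · rfl
    · rfl
    · simp [Config.tick, Config.setNat, eval, eb, hl, ea]
    · exact nb.trans na
    · simp [Config.tick, Config.setNat, cost]
      omega
  | mul a b iha ihb =>
    intro l s hl hs
    obtain ⟨fa, ea, na, ta⟩ := iha he.1 l s hl hs
    set s1 := (a.compile l).exec inp coin s
    obtain ⟨fb, eb, nb, tb⟩ := ihb he.2 (l + 1) s1 (by omega)
      fun r hr => (fa.nat r (by omega)).trans (hs r hr)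
    have hl := fb.nat l (by omega)
    set s2 := (b.compile (l + 1)).exec inp coin s1
    have hex : ((mul a b).compile l).exec inp coin s
        = (((((s2.setNat (l + 2) 0).tick 2).setNat (l + 2) (s2.nat l * s2.nat (l + 1))).setNat l
          0).setNat l (s2.nat l * s2.nat (l + 1))).tick (2 * s2.nat l + 2) := by
      have hloop : ∀ t : Config, (Prog.loop l (.natAdd (l + 2) (l + 2) (l + 1))).exec inp coin t
          = ((t.tick 1).setNat (l + 2) (t.nat (l + 2) + t.nat l * t.nat (l + 1))).tick
            (2 * t.nat l) := fun t => exec_loop_natAdd inp coin l (t.nat l) (t.tick 1)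
      change Prog.exec inp coin (.natAdd l l (l + 2)) (Prog.exec inp coin (.natConst l 0)
        (Prog.exec inp coin (.loop l _) (Prog.exec inp coin (.natConst (l + 2) 0) s2))) = _
      rw [hloop]
      simp [Config.setNat, Config.tick, Prog.exec]
      ring
    rw [hex]
    have f12 := fa.trans (fb.mono (Nat.le_succ l) le_rfl)
    refine ⟨f12.trans ⟨?_, ?_, ?_, ?_⟩, ?_, ?_, ?_⟩
    · intro r hr
      have : r ≠ l + 2 := by omega
      simp [Config.tick, Config.setNat, hr.ne, this]
    · intro u _; rfl
    · rfl
    · rfl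
    · simp [Config.tick, Config.setNat, eval, eb, hl, ea]
    · exact nb.trans na
    · have h2 : s2.nat l = a.eval ρ := hl.trans ea
      simp [Config.tick, Config.setNat, cost, h2]
      omega

end NatExpr

/-- Expressions for complex numbers. In `sum r e`, `prod r e` and `letNat x e` the expression `e`
may use one more natural-number register, the first one that is free at this place: it holds the
summation index, which runs below the content of register `r`, or the value of `x`. -/
inductive NumExpr
  | const (c : ℤ)
  | cast (r : ℕ)
  | add (a b : NumExpr)
  | sub (a b : NumExpr)
  | mul (a b : NumExpr)
  | div (a b : NumExpr)
  | conjugate (a : NumExpr)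
  | load (A : ℕ) (x : NatExpr)
  | read (T : Source) (x y : NatExpr)
  /-- `e` if the real part of `a` is at most that of `b`, and `e'` otherwise. -/
  | ite (a b e e' : NumExpr)
  | sum (r : ℕ) (e : NumExpr)
  | prod (r : ℕ) (e : NumExpr)
  | letNat (x : NatExpr) (e : NumExpr)

namespace NumExpr

open Classical in
/-- The value, for given input tables and arrays, if the registers below `l` are in use and their
contents are `ρ`. -/
def eval (inp : Input) (arr : ℕ → ℕ → ℂ) : NumExpr → ℕ → (ℕ → ℕ) → ℂ
  | const c, _, _ => c
  | cast r, _, ρ => ρ r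
  | add a b, l, ρ => a.eval inp arr l ρ + b.eval inp arr l ρ
  | sub a b, l, ρ => a.eval inp arr l ρ - b.eval inp arr l ρ
  | mul a b, l, ρ => a.eval inp arr l ρ * b.eval inp arr l ρ
  | div a b, l, ρ => a.eval inp arr l ρ / b.eval inp arr l ρ
  | conjugate a, l, ρ => (starRingEnd ℂ) (a.eval inp arr l ρ)
  | load A x, _, ρ => arr A (x.eval ρ)
  | read T x y, _, ρ => inp T (x.eval ρ) (y.eval ρ)
  | ite a b e e', l, ρ => if (a.eval inp arr l ρ).re ≤ (b.eval inp arr l ρ).re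
      then e.eval inp arr l ρ else e'.eval inp arr l ρ
  | sum r e, l, ρ => ∑ i ∈ Finset.range (ρ r), e.eval inp arr (l + 1) (Function.update ρ l i)
  | prod r e, l, ρ => ∏ i ∈ Finset.range (ρ r), e.eval inp arr (l + 1) (Function.update ρ l i)
  | letNat x e, l, ρ => e.eval inp arr (l + 1) (Function.update ρ l (x.eval ρ))

/-- Only registers below `l` and the bound ones occur. -/
def Below : NumExpr → ℕ → Prop
  | const _, _ => True
  | cast r, l => r < l
  | add a b, l => a.Below l ∧ b.Below l
  | sub a b, l => a.Below l ∧ b.Below l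
  | mul a b, l => a.Below l ∧ b.Below l
  | div a b, l => a.Below l ∧ b.Below l
  | conjugate a, l => a.Below l
  | load _ x, l => x.Below l
  | read _ x y, l => x.Below l ∧ y.Below l
  | ite a b e e', l => (a.Below l ∧ b.Below l) ∧ (e.Below l ∧ e'.Below l)
  | sum r e, l => r < l ∧ e.Below (l + 1)
  | prod r e, l => r < l ∧ e.Below (l + 1)
  | letNat x e, l => x.Below l ∧ e.Below (l + 1)

/-- A bound on the running time of the compiled expression. -/
def cost : NumExpr → ℕ → (ℕ → ℕ) → ℕ
  | const _, _, _ => 1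
  | cast _, _, _ => 1
  | add a b, l, ρ => a.cost l ρ + b.cost l ρ + 1
  | sub a b, l, ρ => a.cost l ρ + b.cost l ρ + 1
  | mul a b, l, ρ => a.cost l ρ + b.cost l ρ + 1
  | div a b, l, ρ => a.cost l ρ + b.cost l ρ + 1
  | conjugate a, l, ρ => a.cost l ρ + 1
  | load _ x, _, ρ => x.cost ρ + 1
  | read _ x y, _, ρ => x.cost ρ + y.cost ρ + 1
  | ite a b e e', l, ρ => a.cost l ρ + b.cost l ρ + 1 + (e.cost l ρ + e'.cost l ρ)
  | sum r e, l, ρ => 3 + ∑ i ∈ Finset.range (ρ r), (e.cost (l + 1) (Function.update ρ l i) + 4)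
  | prod r e, l, ρ => 3 + ∑ i ∈ Finset.range (ρ r), (e.cost (l + 1) (Function.update ρ l i) + 4)
  | letNat x e, l, ρ => x.cost ρ + e.cost (l + 1) (Function.update ρ l (x.eval ρ))

/-- The program that writes the value to complex register `d`, using complex registers from `d` on
and natural-number registers from `l` on as workspace. -/
def compile : NumExpr → ℕ → ℕ → Prog
  | const c, d, _ => .numConst d c
  | cast r, d, _ => .numCast d r
  | add a b, d, l => .seq (a.compile d l) (.seq (b.compile (d + 1) l) (.numAdd d d (d + 1)))
  | sub a b, d, l => .seq (a.compile d l) (.seq (b.compile (d + 1) l) (.numSub d d (d + 1)))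
  | mul a b, d, l => .seq (a.compile d l) (.seq (b.compile (d + 1) l) (.numMul d d (d + 1)))
  | div a b, d, l => .seq (a.compile d l) (.seq (b.compile (d + 1) l) (.numDiv d d (d + 1)))
  | conjugate a, d, l => .seq (a.compile d l) (.numConj d d)
  | load A x, d, l => .seq (x.compile l) (.load d A l)
  | read T x y, d, l => .seq (x.compile l) (.seq (y.compile (l + 1)) (.read d T l (l + 1)))
  | ite a b e e', d, l => .seq (a.compile d l) (.seq (b.compile (d + 1) l)
      (.ifNum d (d + 1) (e.compile d l) (e'.compile d l)))
  | sum r e, d, l => .seq (.numConst d 0)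
      (forLoop r l (.seq (e.compile (d + 1) (l + 1)) (.numAdd d d (d + 1))))
  | prod r e, d, l => .seq (.numConst d 1)
      (forLoop r l (.seq (e.compile (d + 1) (l + 1)) (.numMul d d (d + 1))))
  | letNat x e, d, l => .seq (x.compile l) (e.compile d (l + 1))

/-- The claim that `e` is compiled correctly. -/
def Correct (inp : Input) (coin : ℕ → Bool) (e : NumExpr) : Prop :=
  ∀ (l d : ℕ) (s : Config) (ρ : ℕ → ℕ), e.Below l → (∀ r < l, s.nat r = ρ r) →
    Frame l d s ((e.compile d l).exec inp coin s) ∧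
    ((e.compile d l).exec inp coin s).num d = e.eval inp s.arr l ρ ∧
    ((e.compile d l).exec inp coin s).time ≤ s.time + e.cost l ρ

theorem frame_setNum (l d : ℕ) (s : Config) (x : ℂ) (t : ℕ) :
    Frame l d s ((s.setNum d x).tick t) :=
  ⟨fun _ _ => rfl, fun u hu => by simp [Config.tick, Config.setNum, hu.ne], rfl, rfl⟩

/-- Two correctly compiled operands, evaluated one after the other. -/
theorem Correct.pair {inp : Input} {coin : ℕ → Bool} {a b : NumExpr} (ha : a.Correct inp coin)
    (hb : b.Correct inp coin) {l : ℕ} (d : ℕ) {s : Config} {ρ : ℕ → ℕ} (hal : a.Below l)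
    (hbl : b.Below l) (hs : ∀ r < l, s.nat r = ρ r) :
    let s' := (b.compile (d + 1) l).exec inp coin ((a.compile d l).exec inp coin s)
    Frame l d s s' ∧ s'.num d = a.eval inp s.arr l ρ ∧ s'.num (d + 1) = b.eval inp s.arr l ρ ∧
      s'.time ≤ s.time + (a.cost l ρ + b.cost l ρ) := by
  intro s'
  obtain ⟨fa, ea, ta⟩ := ha l d s ρ hal hs
  obtain ⟨fb, eb, tb⟩ := hb l (d + 1) ((a.compile d l).exec inp coin s) ρ hbl
    fun r hr => (fa.nat r hr).trans (hs r hr)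
  refine ⟨fa.trans (fb.mono le_rfl (Nat.le_succ d)), ?_, ?_, ?_⟩
  · rw [fb.num d (Nat.lt_succ_self d), ea]
  · rw [eb, fa.arr]
  · have : s'.time ≤ ((a.compile d l).exec inp coin s).time + b.cost l ρ := tb
    omega

/-- The common part of the correctness of sums and products: `op` is the machine's operation
`opInstr`, and `x` its neutral element. -/
theorem Correct.fold {inp : Input} {coin : ℕ → Bool} {e : NumExpr} (he : e.Correct inp coin)
    {l r : ℕ} (d : ℕ) {s : Config} {ρ : ℕ → ℕ} (hr : r < l) (hel : e.Below (l + 1))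
    (hs : ∀ r < l, s.nat r = ρ r) (x : ℂ) (hx : s.num d = x) (op : ℂ → ℂ → ℂ) (instr : Prog)
    (hinstr : ∀ s : Config, instr.exec inp coin s
      = (s.setNum d (op (s.num d) (s.num (d + 1)))).tick 1)
    (F : ℕ → ℂ) (hF0 : F 0 = x) (hF : ∀ i, F (i + 1)
      = op (F i) (e.eval inp s.arr (l + 1) (Function.update ρ l i))) :
    let s' := (forLoop r l (.seq (e.compile (d + 1) (l + 1)) instr)).exec inp coin s
    Frame l d s s' ∧ s'.num d = F (ρ r) ∧ s'.time ≤ s.time +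
      (2 + ∑ i ∈ Finset.range (ρ r), (e.cost (l + 1) (Function.update ρ l i) + 4)) := by
  intro s'
  have key := forLoop_spec (inp := inp) (coin := coin) (s := s)
    (p := .seq (e.compile (d + 1) (l + 1)) instr) hr
    (fun i t => Frame l d s t ∧ t.num d = F i)
    (fun i => e.cost (l + 1) (Function.update ρ l i) + 1) ?_ ?_ ?_
  · rw [hs r hr] at key
    exact ⟨key.1.1, key.1.2, by simpa [add_assoc] using key.2⟩
  · rintro i t t' ⟨h1, h2⟩ hn hu ha hus
    exact ⟨h1.trans ⟨hn, fun u _ => by rw [hu], ha, hus⟩, by rw [hu, h2]⟩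
  · exact ⟨Frame.refl _ _ _, hx.trans hF0.symm⟩
  · rintro i - t ⟨h1, h2⟩ hti
    obtain ⟨fe, ee, te⟩ := he (l + 1) (d + 1) t (Function.update ρ l i) hel (by
      intro r' hr'
      rcases Nat.lt_succ_iff_lt_or_eq.1 hr' with h | rfl
      · rw [h1.nat r' h, hs r' h, Function.update_of_ne h.ne]
      · simpa using hti)
    simp only [Prog.exec, hinstr]
    set t' := (e.compile (d + 1) (l + 1)).exec inp coin t
    refine ⟨⟨(h1.trans (fe.mono (Nat.le_succ l) (Nat.le_succ d))).trans (frame_setNum _ _ _ _ _),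
      ?_⟩, ?_, ?_⟩
    · simp [Config.tick, Config.setNum, hF, ee, fe.num d (Nat.lt_succ_self d), h2, h1.arr]
    · exact (fe.nat l (Nat.lt_succ_self l)).trans hti
    · simp [Config.tick, Config.setNum]
      omega

/-- Compiled expressions for complex numbers are correct. -/
theorem correct (inp : Input) (coin : ℕ → Bool) (e : NumExpr) : e.Correct inp coin := by
  induction e with
  | const c =>
    intro l d s ρ _ _
    exact ⟨frame_setNum l d s _ 1, by simp [compile, Prog.exec, Config.tick, Config.setNum, eval],
      le_rfl⟩
  | cast r =>
    intro l d s ρ hr hs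
    exact ⟨frame_setNum l d s _ 1, by
      simp [compile, Prog.exec, Config.tick, Config.setNum, eval, hs r hr], le_rfl⟩
  | add a b iha ihb =>
    intro l d s ρ h hs
    obtain ⟨f, e1, e2, t⟩ := iha.pair ihb d h.1 h.2 hs
    refine ⟨f.trans (frame_setNum l d _ _ 1), ?_, ?_⟩
    · simp [compile, Prog.exec, Config.tick, Config.setNum, eval, e1, e2]
    · simp [compile, Prog.exec, Config.tick, Config.setNum, cost]; omega
  | sub a b iha ihb =>
    intro l d s ρ h hs
    obtain ⟨f, e1, e2, t⟩ := iha.pair ihb d h.1 h.2 hs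
    refine ⟨f.trans (frame_setNum l d _ _ 1), ?_, ?_⟩
    · simp [compile, Prog.exec, Config.tick, Config.setNum, eval, e1, e2]
    · simp [compile, Prog.exec, Config.tick, Config.setNum, cost]; omega
  | mul a b iha ihb =>
    intro l d s ρ h hs
    obtain ⟨f, e1, e2, t⟩ := iha.pair ihb d h.1 h.2 hs
    refine ⟨f.trans (frame_setNum l d _ _ 1), ?_, ?_⟩
    · simp [compile, Prog.exec, Config.tick, Config.setNum, eval, e1, e2]
    · simp [compile, Prog.exec, Config.tick, Config.setNum, cost]; omega
  | div a b iha ihb =>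
    intro l d s ρ h hs
    obtain ⟨f, e1, e2, t⟩ := iha.pair ihb d h.1 h.2 hs
    refine ⟨f.trans (frame_setNum l d _ _ 1), ?_, ?_⟩
    · simp [compile, Prog.exec, Config.tick, Config.setNum, eval, e1, e2]
    · simp [compile, Prog.exec, Config.tick, Config.setNum, cost]; omega
  | conjugate a iha =>
    intro l d s ρ h hs
    obtain ⟨f, e1, t⟩ := iha l d s ρ h hs
    refine ⟨f.trans (frame_setNum l d _ _ 1), ?_, ?_⟩
    · simp [compile, Prog.exec, Config.tick, Config.setNum, eval, e1]
    · simp [compile, Prog.exec, Config.tick, Config.setNum, cost]; omega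
  | load A x =>
    intro l d s ρ h hs
    obtain ⟨f, e1, -, t⟩ := x.compile_spec inp coin d h l s le_rfl hs
    refine ⟨f.trans (frame_setNum l d _ _ 1), ?_, ?_⟩
    · simp [compile, Prog.exec, Config.tick, Config.setNum, eval, e1, f.arr]
    · simp [compile, Prog.exec, Config.tick, Config.setNum, cost]; omega
  | read T x y =>
    intro l d s ρ h hs
    obtain ⟨f, e1, -, t⟩ := x.compile_spec inp coin d h.1 l s le_rfl hs
    obtain ⟨f', e1', -, t'⟩ := y.compile_spec inp coin d h.2 (l + 1)
      ((x.compile l).exec inp coin s) (Nat.le_succ l) fun r hr => (f.nat r hr).trans (hs r hr)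
    refine ⟨(f.trans (f'.mono (Nat.le_succ l) le_rfl)).trans (frame_setNum l d _ _ 1), ?_, ?_⟩
    · simp [compile, Prog.exec, Config.tick, Config.setNum, eval, e1, e1',
        f'.nat l (Nat.lt_succ_self l)]
    · simp [compile, Prog.exec, Config.tick, Config.setNum, cost]; omega
  | ite a b e e' iha ihb ihe ihe' =>
    intro l d s ρ h hs
    obtain ⟨f, e1, e2, t⟩ := iha.pair ihb d h.1.1 h.1.2 hs
    simp only [compile, Prog.exec, eval, cost, e1, e2]
    set s2 := (b.compile (d + 1) l).exec inp coin ((a.compile d l).exec inp coin s)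
    have f' : Frame l d s (s2.tick 1) := f.trans ⟨fun _ _ => rfl, fun _ _ => rfl, rfl, rfl⟩
    have hs' : ∀ r < l, (s2.tick 1).nat r = ρ r := fun r hr => (f'.nat r hr).trans (hs r hr)
    have ht : (s2.tick 1).time = s2.time + 1 := rfl
    split_ifs
    · obtain ⟨g, e3, t3⟩ := ihe l d (s2.tick 1) ρ h.2.1 hs'
      exact ⟨f'.trans g, by rw [e3, f'.arr], by omega⟩
    · obtain ⟨g, e3, t3⟩ := ihe' l d (s2.tick 1) ρ h.2.2 hs'
      exact ⟨f'.trans g, by rw [e3, f'.arr], by omega⟩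
  | sum r e ih =>
    intro l d s ρ h hs
    have f := frame_setNum l d s 0 1
    obtain ⟨f', e1, t⟩ := ih.fold (s := (s.setNum d 0).tick 1) d h.1 h.2 hs 0
      (by simp [Config.tick, Config.setNum]) (· + ·) (.numAdd d d (d + 1)) (fun _ => rfl)
      (fun N => ∑ i ∈ Finset.range N, e.eval inp s.arr (l + 1) (Function.update ρ l i)) (by simp)
      (fun i => Finset.sum_range_succ _ _)
    simp only [compile, Prog.exec, eval, cost, Int.cast_zero]
    refine ⟨f.trans f', e1, t.trans ?_⟩
    simp [Config.tick, Config.setNum]; omega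
  | prod r e ih =>
    intro l d s ρ h hs
    have f := frame_setNum l d s 1 1
    obtain ⟨f', e1, t⟩ := ih.fold (s := (s.setNum d 1).tick 1) d h.1 h.2 hs 1
      (by simp [Config.tick, Config.setNum]) (· * ·) (.numMul d d (d + 1)) (fun _ => rfl)
      (fun N => ∏ i ∈ Finset.range N, e.eval inp s.arr (l + 1) (Function.update ρ l i)) (by simp)
      (fun i => Finset.prod_range_succ _ _)
    simp only [compile, Prog.exec, eval, cost, Int.cast_one]
    refine ⟨f.trans f', e1, t.trans ?_⟩
    simp [Config.tick, Config.setNum]; omega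
  | letNat x e ih =>
    intro l d s ρ h hs
    obtain ⟨f, e1, -, t⟩ := x.compile_spec inp coin d h.1 l s le_rfl hs
    obtain ⟨f', e2, t'⟩ := ih (l + 1) d ((x.compile l).exec inp coin s)
      (Function.update ρ l (x.eval ρ)) h.2 (by
        intro r hr
        rcases Nat.lt_succ_iff_lt_or_eq.1 hr with h | rfl
        · rw [f.nat r h, hs r h, Function.update_of_ne h.ne]
        · simpa using e1)
    simp only [compile, Prog.exec, eval, cost]
    exact ⟨f.trans (f'.mono (Nat.le_succ l) le_rfl), by rw [e2, f.arr], by omega⟩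

end NumExpr

/-! ### Building blocks of the program -/

/-- Set register `r` to the value of `e`, rounded up. -/
def assignNat (r l : ℕ) (e : NumExpr) : Prog :=
  .seq (e.compile 0 l) (.countTo r 0)

theorem assignNat_spec (inp : Input) (coin : ℕ → Bool) {r l : ℕ} {e : NumExpr} (he : e.Below l)
    (s : Config) {x : ℕ} (hx : ⌈(e.eval inp s.arr l s.nat).re⌉₊ = x) :
    let s' := (assignNat r l e).exec inp coin s
    (∀ r' < l, s'.nat r' = Function.update s.nat r x r') ∧ s'.arr = s.arr ∧ s'.used = s.used ∧
      s'.time ≤ s.time + (e.cost l s.nat + (x + 1)) := by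
  obtain ⟨f, e1, t⟩ := e.correct inp coin l 0 s s.nat he fun _ _ => rfl
  simp only [assignNat, Prog.exec, e1, hx]
  refine ⟨fun r' hr' => ?_, f.arr, f.used, ?_⟩
  · rcases eq_or_ne r' r with rfl | h
    · simp [Config.tick, Config.setNat]
    · simp [Config.tick, Config.setNat, h, f.nat r' hr']
  · simp [Config.tick, Config.setNat]
    omega

/-- The address `(i * n₂ + j) * n₃ + k`, where `n₂` and `n₃` are in registers `r₂` and `r₃`, and
`i`, `j`, `k` are in registers `l`, `l + 1`, `l + 2`. -/
def addressExpr (r₂ r₃ l : ℕ) : NatExpr :=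
  .add (.mul (.var r₃) (.add (.mul (.var r₂) (.var l)) (.var (l + 1)))) (.var (l + 2))

/-- Fill a three-dimensional array: `A[(i * n₂ + j) * n₃ + k] := e` for all `i < n₁`, `j < n₂`,
`k < n₃`, where the bounds are in registers `r₁`, `r₂`, `r₃` and `e` finds the indices in registers
`l`, `l + 1`, `l + 2`. -/
def fill (A r₁ r₂ r₃ l : ℕ) (e : NumExpr) : Prog :=
  forLoop r₁ l (forLoop r₂ (l + 1) (forLoop r₃ (l + 2)
    (.seq (e.compile 0 (l + 3)) (.seq ((addressExpr r₂ r₃ l).compile (l + 3))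
      (.store A (l + 3) 0)))))

/-- The register contents `ρ`, updated by three loop indices. -/
def withIndices (ρ : ℕ → ℕ) (l i j k : ℕ) : ℕ → ℕ :=
  Function.update (Function.update (Function.update ρ l i) (l + 1) j) (l + 2) k

/-- The invariant of `fill`: the first `p` entries of array `A` hold the values `w`. -/
structure Filled (s₀ : Config) (l A : ℕ) (w : ℕ → ℂ) (p : ℕ) (s : Config) : Prop where
  nat : ∀ r < l, s.nat r = s₀.nat r
  used : s.used = s₀.used
  arr : ∀ B ≠ A, s.arr B = s₀.arr B
  val : ∀ q < p, s.arr A q = w q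

theorem Filled.congr {s₀ : Config} {l A : ℕ} {w : ℕ → ℂ} {p : ℕ} {s s' : Config}
    (h : Filled s₀ l A w p s) (hn : ∀ r < l, s'.nat r = s.nat r) (ha : s'.arr = s.arr)
    (hu : s'.used = s.used) : Filled s₀ l A w p s' :=
  ⟨fun r hr => (hn r hr).trans (h.nat r hr), hu.trans h.used, fun B hB => by rw [ha, h.arr B hB],
    fun q hq => by rw [ha, h.val q hq]⟩

theorem Filled.setArr {s₀ : Config} {l A : ℕ} {w : ℕ → ℂ} {p : ℕ} {s : Config}
    (h : Filled s₀ l A w p s) {x : ℂ} (hx : x = w p) (t : ℕ) :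
    Filled s₀ l A w (p + 1) ((s.setArr A p x).tick t) := by
  refine ⟨h.nat, h.used, fun B hB => ?_, fun q hq => ?_⟩
  · simp [Config.tick, Config.setArr, hB, h.arr B hB]
  · rcases Nat.lt_succ_iff_lt_or_eq.1 hq with h' | rfl
    · simp [Config.tick, Config.setArr, h'.ne, h.val q h']
    · simp [Config.tick, Config.setArr, hx]

/-- `fill_spec` with the values indexed by addresses, the form that suits the induction. The value
`w q` must be that of `e` at the indices with address `q`. -/
theorem fill_spec_linear (inp : Input) (coin : ℕ → Bool) {A r₁ r₂ r₃ l : ℕ} {e : NumExpr}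
    (h₁ : r₁ < l) (h₂ : r₂ < l) (h₃ : r₃ < l) (he : e.Below (l + 3)) (s : Config) {n₁ n₂ n₃ : ℕ}
    (hn₁ : s.nat r₁ = n₁) (hn₂ : s.nat r₂ = n₂) (hn₃ : s.nat r₃ = n₃) (w : ℕ → ℂ)
    (hw : ∀ arr : ℕ → ℕ → ℂ, (∀ B ≠ A, arr B = s.arr B) → ∀ i < n₁, ∀ j < n₂, ∀ k < n₃,
      e.eval inp arr (l + 3) (withIndices s.nat l i j k) = w ((i * n₂ + j) * n₃ + k))
    (c : ℕ) (hc : ∀ i < n₁, ∀ j < n₂, ∀ k < n₃,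
      e.cost (l + 3) (withIndices s.nat l i j k) ≤ c) :
    let s' := (fill A r₁ r₂ r₃ l e).exec inp coin s
    Filled s l A w (n₁ * n₂ * n₃) s' ∧
      s'.time ≤ s.time + (2 + n₁ * (5 + n₂ * (5 + n₃ * (c + 2 * n₂ + 2 * n₃ + 24)))) := by
  intro s'
  set T₃ := c + 2 * n₂ + 2 * n₃ + 21 with hT₃
  set T₂ := 2 + n₃ * (T₃ + 3) with hT₂
  set T₁ := 2 + n₂ * (T₂ + 3) with hT₁
  have key := forLoop_spec (inp := inp) (coin := coin) (s := s) h₁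
    (p := forLoop r₂ (l + 1) (forLoop r₃ (l + 2)
      (.seq (e.compile 0 (l + 3)) (.seq ((addressExpr r₂ r₃ l).compile (l + 3))
      (.store A (l + 3) 0))))) (fun i t => Filled s l A w (i * n₂ * n₃) t) (fun _ => T₁)
    (fun i t t' ht hn _ ha hu => ht.congr hn ha hu)
    ⟨fun _ _ => rfl, rfl, fun _ _ => rfl, fun q hq => by simp at hq⟩ ?_
  · rw [hn₁] at key
    refine ⟨key.1, key.2.trans ?_⟩
    simp only [Finset.sum_const, Finset.card_range, smul_eq_mul]
    apply le_of_eq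
    simp only [hT₁, hT₂, hT₃]
    ring
  intro i hi t ht hti
  rw [hn₁] at hi
  have hr₂ : t.nat r₂ = n₂ := (ht.nat _ h₂).trans hn₂
  have key := forLoop_spec (inp := inp) (coin := coin) (s := t) (r := r₂) (l := l + 1) (by omega)
    (p := forLoop r₃ (l + 2)
      (.seq (e.compile 0 (l + 3)) (.seq ((addressExpr r₂ r₃ l).compile (l + 3))
      (.store A (l + 3) 0))))
    (fun j t => Filled s l A w ((i * n₂ + j) * n₃) t ∧ t.nat l = i) (fun _ => T₂)
    (fun j t t' ht hn _ ha hu => ⟨ht.1.congr (fun r hr => hn r (by omega)) ha hu,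
      (hn l (by omega)).trans ht.2⟩)
    ⟨by simpa using ht, hti⟩ ?_
  · rw [hr₂] at key
    refine ⟨?_, key.1.2, key.2.trans ?_⟩
    · convert key.1.1 using 1
      ring
    · simp [hT₁]
  intro j hj t ht htj
  rw [hr₂] at hj
  have hr₃ : t.nat r₃ = n₃ := (ht.1.nat _ h₃).trans hn₃
  have key := forLoop_spec (inp := inp) (coin := coin) (s := t) (r := r₃) (l := l + 2) (by omega)
    (p := .seq (e.compile 0 (l + 3)) (.seq ((addressExpr r₂ r₃ l).compile (l + 3))
      (.store A (l + 3) 0)))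
    (fun k t => Filled s l A w ((i * n₂ + j) * n₃ + k) t ∧ t.nat l = i ∧ t.nat (l + 1) = j)
    (fun _ => T₃)
    (fun k t t' ht hn _ ha hu => ⟨ht.1.congr (fun r hr => hn r (by omega)) ha hu,
      (hn l (by omega)).trans ht.2.1, (hn (l + 1) (by omega)).trans ht.2.2⟩)
    ⟨by simpa using ht.1, ht.2, htj⟩ ?_
  · rw [hr₃] at key
    refine ⟨⟨?_, key.1.2.1⟩, key.1.2.2, key.2.trans ?_⟩
    · convert key.1.1 using 1
      ring
    · simp [hT₂]
  intro k hk t ht htk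
  rw [hr₃] at hk
  obtain ⟨ht, hti, htj⟩ := ht
  have hρ : ∀ r < l + 3, t.nat r = withIndices s.nat l i j k r := by
    intro r hr
    rcases (by omega : r < l ∨ r = l ∨ r = l + 1 ∨ r = l + 2) with h | rfl | rfl | rfl
    · have h1 : r ≠ l + 1 := by omega
      have h2 : r ≠ l + 2 := by omega
      simp [withIndices, h.ne, h1, h2, ht.nat r h]
    all_goals simp [withIndices, hti, htj, htk]
  obtain ⟨f, e1, te⟩ := e.correct inp coin (l + 3) 0 t _ he hρ
  rw [hw t.arr ht.arr i hi j hj k hk] at e1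
  have hc' := hc i hi j hj k hk
  have ha : (addressExpr r₂ r₃ l).Below (l + 3) := by
    simp only [addressExpr, NatExpr.Below]
    omega
  obtain ⟨f', a1, a2, ta⟩ := (addressExpr r₂ r₃ l).compile_spec inp coin 0 ha (l + 3)
    ((e.compile 0 (l + 3)).exec inp coin t) le_rfl fun r hr => (f.nat r hr).trans (hρ r hr)
  have hw₂ : withIndices s.nat l i j k r₂ = n₂ := by rw [← hρ r₂ (by omega), ht.nat r₂ h₂, hn₂]
  have hw₃ : withIndices s.nat l i j k r₃ = n₃ := by rw [← hρ r₃ (by omega), ht.nat r₃ h₃, hn₃]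
  have hwi : withIndices s.nat l i j k l = i := by rw [← hρ l (by omega), hti]
  have hwj : withIndices s.nat l i j k (l + 1) = j := by rw [← hρ (l + 1) (by omega), htj]
  have hwk : withIndices s.nat l i j k (l + 2) = k := by rw [← hρ (l + 2) (by omega), htk]
  have hae : (addressExpr r₂ r₃ l).eval (withIndices s.nat l i j k) = (i * n₂ + j) * n₃ + k := by
    simp only [addressExpr, NatExpr.eval, hw₂, hw₃, hwi, hwj, hwk]
    ring
  have hac : (addressExpr r₂ r₃ l).cost (withIndices s.nat l i j k) = 2 * n₂ + 2 * n₃ + 20 := by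
    simp only [addressExpr, NatExpr.cost, NatExpr.eval, hw₂, hw₃]
    ring
  rw [hae] at a1
  rw [hac] at ta
  have g := f.trans f'
  simp only [Prog.exec]
  set t₁ := (e.compile 0 (l + 3)).exec inp coin t
  set t₂ := ((addressExpr r₂ r₃ l).compile (l + 3)).exec inp coin t₁
  rw [a1, a2, e1]
  have hF : Filled s l A w ((i * n₂ + j) * n₃ + k) t₂ :=
    ht.congr (fun r hr => g.nat r (by omega)) g.arr g.used
  rw [← add_assoc]
  generalize (i * n₂ + j) * n₃ + k = p at hF ⊢
  clear_value t₁ t₂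
  have hF' := hF.setArr (x := w p) rfl 1
  refine ⟨⟨hF', ?_, ?_⟩, ?_, ?_⟩
  · exact (g.nat l (by omega)).trans hti
  · exact (g.nat (l + 1) (by omega)).trans htj
  · exact (g.nat (l + 2) (by omega)).trans htk
  · simp [Config.tick, Config.setArr, hT₃]
    omega

/-- The correctness and the running time of `fill`, for an expression `e` whose values `v i j k` do
not depend on the array `A` that is being filled. -/
theorem fill_spec (inp : Input) (coin : ℕ → Bool) {A r₁ r₂ r₃ l : ℕ} {e : NumExpr} (h₁ : r₁ < l)
    (h₂ : r₂ < l) (h₃ : r₃ < l) (he : e.Below (l + 3)) (s : Config) {n₁ n₂ n₃ : ℕ}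
    (hn₁ : s.nat r₁ = n₁) (hn₂ : s.nat r₂ = n₂) (hn₃ : s.nat r₃ = n₃) (v : ℕ → ℕ → ℕ → ℂ) (c : ℕ)
    (hv : ∀ arr : ℕ → ℕ → ℂ, (∀ B ≠ A, arr B = s.arr B) → ∀ i < n₁, ∀ j < n₂, ∀ k < n₃,
      e.eval inp arr (l + 3) (withIndices s.nat l i j k) = v i j k)
    (hc : ∀ i < n₁, ∀ j < n₂, ∀ k < n₃, e.cost (l + 3) (withIndices s.nat l i j k) ≤ c) :
    let s' := (fill A r₁ r₂ r₃ l e).exec inp coin s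
    (∀ r < l, s'.nat r = s.nat r) ∧ s'.used = s.used ∧ (∀ B ≠ A, s'.arr B = s.arr B) ∧
      (∀ i < n₁, ∀ j < n₂, ∀ k < n₃, s'.arr A ((i * n₂ + j) * n₃ + k) = v i j k) ∧
      s'.time ≤ s.time + (2 + n₁ * (5 + n₂ * (5 + n₃ * (c + 2 * n₂ + 2 * n₃ + 24)))) := by
  intro s'
  set w : ℕ → ℂ := fun q => v (q / n₃ / n₂) (q / n₃ % n₂) (q % n₃)
  have hw : ∀ i, ∀ j < n₂, ∀ k < n₃, w ((i * n₂ + j) * n₃ + k) = v i j k := by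
    intro i j hj k hk
    have h3 : ((i * n₂ + j) * n₃ + k) / n₃ = i * n₂ + j := by
      rw [mul_comm, Nat.mul_add_div (by omega), Nat.div_eq_of_lt hk, add_zero]
    have h3' : ((i * n₂ + j) * n₃ + k) % n₃ = k := by
      rw [mul_comm, Nat.mul_add_mod, Nat.mod_eq_of_lt hk]
    have h2 : (i * n₂ + j) / n₂ = i := by
      rw [mul_comm, Nat.mul_add_div (by omega), Nat.div_eq_of_lt hj, add_zero]
    have h2' : (i * n₂ + j) % n₂ = j := by
      rw [mul_comm, Nat.mul_add_mod, Nat.mod_eq_of_lt hj]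
    simp only [w, h3, h3', h2, h2']
  obtain ⟨f, t⟩ := fill_spec_linear inp coin h₁ h₂ h₃ he s hn₁ hn₂ hn₃ w
    (fun arr harr i hi j hj k hk => (hv arr harr i hi j hj k hk).trans (hw i j hj k hk).symm) c hc
  refine ⟨f.nat, f.used, f.arr, fun i hi j hj k hk => ?_, t⟩
  rw [f.val _ ?_, hw i j hj k hk]
  calc (i * n₂ + j) * n₃ + k < (i * n₂ + j) * n₃ + n₃ := by omega
    _ = (i * n₂ + j + 1) * n₃ := by ring
    _ ≤ (i * n₂ + n₂) * n₃ := Nat.mul_le_mul_right _ (by omega)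
    _ = (i + 1) * n₂ * n₃ := by ring
    _ ≤ n₁ * n₂ * n₃ := Nat.mul_le_mul_right _ (Nat.mul_le_mul_right _ hi)

/-- The sign that a coin stands for. -/
def coinSign (b : Bool) : ℂ := if b then -1 else 1

/-- Fill array `A` with as many random signs as register `r` says. -/
def tossSigns (A r l : ℕ) : Prog :=
  forLoop r l (.seq (.toss (l + 1)) (.seq (.numCast 0 (l + 1)) (.seq (.numAdd 0 0 0)
    (.seq (.numConst 1 1) (.seq (.numSub 0 1 0) (.store A l 0))))))

theorem tossSigns_spec (inp : Input) (coin : ℕ → Bool) {A r l : ℕ} (hr : r < l) (s : Config)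
    (hs : s.used = 0) :
    let s' := (tossSigns A r l).exec inp coin s
    (∀ r < l, s'.nat r = s.nat r) ∧ (∀ B ≠ A, s'.arr B = s.arr B) ∧
      (∀ q < s.nat r, s'.arr A q = coinSign (coin q)) ∧ s'.time ≤ s.time + (2 + s.nat r * 9) := by
  intro s'
  have key := forLoop_spec (inp := inp) (coin := coin) (s := s) hr
    (p := .seq (.toss (l + 1)) (.seq (.numCast 0 (l + 1)) (.seq (.numAdd 0 0 0)
      (.seq (.numConst 1 1) (.seq (.numSub 0 1 0) (.store A l 0))))))
    (fun i t => (∀ r < l, t.nat r = s.nat r) ∧ t.used = i ∧ (∀ B ≠ A, t.arr B = s.arr B) ∧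
      ∀ q < i, t.arr A q = coinSign (coin q)) (fun _ => 6)
    (fun i t t' ht hn _ ha hu => ⟨fun r hr => (hn r hr).trans (ht.1 r hr), hu.trans ht.2.1,
      fun B hB => by rw [ha, ht.2.2.1 B hB], fun q hq => by rw [ha, ht.2.2.2 q hq]⟩)
    ⟨fun _ _ => rfl, hs, fun _ _ => rfl, fun q hq => by simp at hq⟩ ?_
  · refine ⟨key.1.1, key.1.2.2.1, key.1.2.2.2, key.2.trans ?_⟩
    simp
  rintro i - t ⟨h1, h2, h3, h4⟩ hti
  refine ⟨⟨?_, ?_, ?_, ?_⟩, ?_, ?_⟩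
  · intro r hr
    have : r ≠ l + 1 := by omega
    simp [Prog.exec, Config.tick, Config.setNat, Config.setNum, Config.setArr, this, h1 r hr]
  · simp [Prog.exec, Config.tick, Config.setNat, Config.setNum, Config.setArr, h2]
  · intro B hB
    simp [Prog.exec, Config.tick, Config.setNat, Config.setNum, Config.setArr, hB, h3 B hB]
  · intro q hq
    rcases Nat.lt_succ_iff_lt_or_eq.1 hq with h' | rfl
    · simp [Prog.exec, Config.tick, Config.setNat, Config.setNum, Config.setArr, hti, h'.ne,
        h4 q h']
    · simp [Prog.exec, Config.tick, Config.setNat, Config.setNum, Config.setArr, hti, h2, coinSign]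
      split_ifs <;> norm_num
  · simp [Prog.exec, Config.tick, Config.setNat, Config.setNum, Config.setArr, hti]
  · simp [Prog.exec, Config.tick, Config.setNat, Config.setNum, Config.setArr]

/-! ### The algorithm -/

/-!
Natural-number registers 0 to 6 hold the number `n` of photons, the number of modes, the number `K`
of bins, the number `(n + 1) ^ K` of grid points, the number of samples, the constant 1, and the
number of coins to be tossed. Array 0 is the output; arrays 1 to 5 hold the overlaps of the bins,
the random signs, the digits of the grid points, their phases, and the estimates of the
characteristic function.
-/

section Expressions
open NumExpr NatExpr

/-- The entry `i, j` (registers 7, 8) of the overlap matrix of bin `z` (register 9). -/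
def overlapExpr : NumExpr :=
  .sum 1 (.mul (.read .bins (.var 9) (.var 10))
    (.mul (.conjugate (.read .interferometer (.var 7) (.var 10)))
      (.read .interferometer (.var 8) (.var 10))))

/-- The preparatory phase. -/
def prepProg (K : ℕ) : Prog :=
  .seq (.natConst 2 K) (fill 1 0 0 2 7 overlapExpr)

/-- The number of grid points. -/
def gridExpr : NumExpr := .prod 2 (.add (.cast 0) (.const 1))

/-- The number of samples, before rounding. -/
def samplesExpr (c : ℕ) : NumExpr :=
  .div (.mul (.const c) (.cast 3))
    (.mul (.read .accuracy (.const 0) (.const 0)) (.read .accuracy (.const 0) (.const 0)))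

/-- The integral part of `a / (n + 1) ^ r`, where `a` is in register 7, is the number of multiples
of `(n + 1) ^ r` among `1, …, a`. Here `x` is the expression for `(n + 1) ^ r`. -/
def quotExpr (x : NumExpr) : NumExpr :=
  .sum 3 (.ite (.mul (.add (.cast 10) (.const 1)) x) (.cast 7) (.const 1) (.const 0))

/-- The power `(n + 1) ^ z`, where `z` is in register 9. -/
def placeExpr : NumExpr := .prod 9 (.add (.cast 0) (.const 1))

/-- Digit `z` (register 9) of the number in register 7, in base `n + 1`. -/
def digitExpr : NumExpr :=
  .sub (quotExpr placeExpr)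
    (.mul (.add (.cast 0) (.const 1)) (quotExpr (.mul placeExpr (.add (.cast 0) (.const 1)))))

/-- The root of unity, raised to digit `z` (register 9) of the number in register 7. -/
def phaseExpr : NumExpr :=
  .prod 0 (.ite (.add (.cast 10) (.const 1)) (.load 3 (.add (.mul (.var 2) (.var 7)) (.var 9)))
    (.read .root (.const 0) (.const 0)) (.const 1))

/-- The average of the Glynn estimators of the value of the characteristic function at the grid
point in register 7. The number of a sample is in register 11, the row in register 13, the column
in register 15 and the bin in register 17; registers 10, 12, 14 and 16 hold addresses of rows. -/
def estimateExpr : NumExpr :=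
  .div (.letNat (.mul (.var 2) (.var 7)) (.sum 4 (.letNat (.mul (.var 0) (.var 11)) (.prod 0
    (.letNat (.mul (.var 0) (.var 13)) (.mul (.load 2 (.add (.var 12) (.var 13)))
      (.add (.load 2 (.add (.var 12) (.var 13)))
        (.sum 0 (.mul (.mul (.load 2 (.add (.var 12) (.var 15))) (.read .gram (.var 13) (.var 15)))
          (.letNat (.mul (.var 2) (.add (.var 14) (.var 15)))
            (.sum 2 (.mul (.sub (.load 4 (.add (.var 10) (.var 17))) (.const 1))
              (.load 1 (.add (.var 16) (.var 17)))))))))))))))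
    (.cast 4)

/-- The Fourier coefficient with the index in register 7. -/
def fourierExpr : NumExpr :=
  .div (.sum 3 (.mul (.load 5 (.var 10)) (.prod 2 (.prod 0
    (.ite (.add (.cast 12) (.const 1)) (.load 3 (.add (.mul (.var 2) (.var 7)) (.var 11)))
      (.conjugate (.load 4 (.add (.mul (.var 2) (.var 10)) (.var 11)))) (.const 1))))))
    (.cast 3)

/-- The main phase, with `c` times the number of grid points, divided by the square of the
accuracy, as the number of samples. -/
def mainProg (K c : ℕ) : Prog :=
  .seq (.natConst 2 K) <| .seq (assignNat 3 7 gridExpr) <| .seq (assignNat 4 7 (samplesExpr c)) <|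
  .seq (.natConst 5 1) <| .seq (assignNat 6 7 (.mul (.cast 0) (.cast 4))) <|
  .seq (tossSigns 2 6 7) <| .seq (fill 3 3 5 2 7 digitExpr) <| .seq (fill 4 3 5 2 7 phaseExpr) <|
  .seq (fill 5 3 5 5 7 estimateExpr) <|
  fill 0 3 5 5 7 (.div (.add fourierExpr (.conjugate fourierExpr)) (.const 2))

end Expressions

/-- The overlap of the amplitudes of rows `i` and `j` in bin `z`. -/
def overlap (inp : Input) (m i j z : ℕ) : ℂ :=
  ∑ k ∈ Finset.range m, inp .bins z k *
    (conj (inp .interferometer i k) * inp .interferometer j k)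

theorem prepProg_spec (K : ℕ) (inp : Input) (coin : ℕ → Bool) (n m : ℕ) :
    let s := (prepProg K).exec inp coin (initial n m)
    s.nat 0 = n ∧ s.used = 0 ∧
    (∀ i < n, ∀ j < n, ∀ z < K, s.arr 1 ((i * n + j) * K + z) = overlap inp m i j z) ∧
    s.time ≤ 3 + n * (5 + n * (5 + K * (22 * m + 2 * n + 2 * K + 27))) := by
  intro s
  set s1 : Config := ((initial n m).setNat 2 K).tick 1 with hs1
  have hs : s = (fill 1 0 0 2 7 overlapExpr).exec inp coin s1 := rfl
  have h0 : s1.nat 0 = n := by simp [hs1, Config.setNat, Config.tick, initial]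
  have h1 : s1.nat 1 = m := by simp [hs1, Config.setNat, Config.tick, initial]
  have h2 : s1.nat 2 = K := by simp [hs1, Config.setNat, Config.tick, initial]
  have hv : ∀ arr : ℕ → ℕ → ℂ, (∀ B ≠ 1, arr B = s1.arr B) → ∀ i < n, ∀ j < n, ∀ z < K,
      overlapExpr.eval inp arr (7 + 3) (withIndices s1.nat 7 i j z) = overlap inp m i j z := by
    intro arr _ i _ j _ z _
    simp [overlapExpr, NumExpr.eval, NatExpr.eval, withIndices, Function.update, h1, overlap]
  have hc : ∀ i < n, ∀ j < n, ∀ z < K,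
      overlapExpr.cost (7 + 3) (withIndices s1.nat 7 i j z) ≤ 22 * m + 3 := by
    intro i _ j _ z _
    simp [overlapExpr, NumExpr.cost, NatExpr.cost, withIndices, Function.update, h1]
    omega
  obtain ⟨fn, fu, -, fv, t⟩ := fill_spec inp coin (A := 1) (r₁ := 0) (r₂ := 0) (r₃ := 2) (l := 7)
    (e := overlapExpr) (by norm_num) (by norm_num) (by norm_num)
    (by simp [overlapExpr, NumExpr.Below, NatExpr.Below]) s1 h0 h0 h2
    (overlap inp m) (22 * m + 3) hv hc
  refine ⟨(fn 0 (by norm_num)).trans h0, fu, fv, t.trans (le_of_eq ?_)⟩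
  have : s1.time = 1 := rfl
  rw [this]
  ring

/-- Digit `z` of `a` in base `n + 1`. -/
def digit (n a z : ℕ) : ℕ := a / (n + 1) ^ z % (n + 1)

theorem sum_ite_mul_le {a M B : ℕ} (ha : a < M) (hB : 0 < B) :
    ∑ r ∈ Finset.range M, (if ((r : ℝ) + 1) * B ≤ a then (1 : ℂ) else 0) = (a / B : ℕ) := by
  have h : ∀ r : ℕ, ((r : ℝ) + 1) * B ≤ a ↔ r < a / B := by
    intro r
    rw [← Nat.succ_le_iff, Nat.le_div_iff_mul_le hB]
    exact_mod_cast Iff.rfl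
  simp only [h]
  rw [Finset.sum_ite, Finset.sum_const_zero, add_zero, Finset.sum_const, nsmul_eq_mul, mul_one]
  congr 1
  have : (Finset.range M).filter (fun r => r < a / B) = Finset.range (a / B) := by
    ext r
    have := Nat.div_le_self a B
    simp only [Finset.mem_filter, Finset.mem_range]
    omega
  rw [this, Finset.card_range]

theorem digit_eq (n a z : ℕ) :
    ((a / (n + 1) ^ z : ℕ) : ℂ) - (n + 1) * (a / ((n + 1) ^ z * (n + 1)) : ℕ) = digit n a z := by
  rw [digit, ← Nat.div_div_eq_div_mul]
  have := Nat.div_add_mod (a / (n + 1) ^ z) (n + 1)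
  generalize a / (n + 1) ^ z = q at *
  have h2 : ((n : ℂ) + 1) * (q / (n + 1) : ℕ) + (q % (n + 1) : ℕ) = q := by exact_mod_cast this
  rw [← h2]
  ring

theorem prod_ite_add_one_le {n d : ℕ} (hd : d ≤ n) (x : ℂ) :
    ∏ r ∈ Finset.range n, (if (r : ℝ) + 1 ≤ d then x else 1) = x ^ d := by
  have h : ∀ r : ℕ, (r : ℝ) + 1 ≤ d ↔ r < d := by
    intro r
    rw [← Nat.succ_le_iff]
    exact_mod_cast Iff.rfl
  simp only [h]
  rw [Finset.prod_ite, Finset.prod_const_one, mul_one, Finset.prod_const]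
  congr 1
  have : (Finset.range n).filter (fun r => r < d) = Finset.range d := by
    ext r
    simp only [Finset.mem_filter, Finset.mem_range]
    omega
  rw [this, Finset.card_range]

/-- The estimate of the characteristic function at grid point `a` from the signs `sg`, the overlaps
`H`, the Gram matrix `G` and the root of unity `ω`. -/
def estimate (n K N : ℕ) (sg : ℕ → ℂ) (H : ℕ → ℕ → ℕ → ℂ) (G : ℕ → ℕ → ℂ) (ω : ℂ) (a : ℕ) : ℂ :=
  (∑ t ∈ Finset.range N, ∏ i ∈ Finset.range n, sg (n * t + i) *
    (sg (n * t + i) + ∑ j ∈ Finset.range n, sg (n * t + j) * G i j *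
      ∑ z ∈ Finset.range K, (ω ^ digit n a z - 1) * H i j z)) / N

/-- The Fourier coefficient `b` of `X`. -/
def fourier (n K : ℕ) (ω : ℂ) (X : ℕ → ℂ) (b : ℕ) : ℂ :=
  (∑ a ∈ Finset.range ((n + 1) ^ K), X a * ∏ z ∈ Finset.range K,
    conj (ω ^ digit n a z) ^ digit n b z) / ((n + 1) ^ K : ℕ)

theorem placeExpr_eval (inp : Input) (arr : ℕ → ℕ → ℂ) {ρ : ℕ → ℕ} {n z l : ℕ} (h0 : ρ 0 = n)
    (h9 : ρ 9 = z) (hl : 10 ≤ l) : placeExpr.eval inp arr l ρ = ((n + 1) ^ z : ℕ) := by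
  have : 0 ≠ l := by omega
  simp [placeExpr, NumExpr.eval, Function.update, h0, h9, this]

theorem placeExpr_cost {ρ : ℕ → ℕ} {z l : ℕ} (h9 : ρ 9 = z) :
    placeExpr.cost l ρ = 3 + 7 * z := by
  simp [placeExpr, NumExpr.cost, h9, mul_comm]

theorem quotExpr_eval (inp : Input) (arr : ℕ → ℕ → ℂ) {x : NumExpr} {ρ : ℕ → ℕ} {M a B : ℕ}
    (h3 : ρ 3 = M) (h7 : ρ 7 = a) (ha : a < M) (hB : 0 < B)
    (hx : ∀ r, x.eval inp arr 11 (Function.update ρ 10 r) = B) :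
    (quotExpr x).eval inp arr 10 ρ = (a / B : ℕ) := by
  rw [← sum_ite_mul_le ha hB]
  simp [quotExpr, NumExpr.eval, h3, h7, hx]

theorem digitExpr_eval (inp : Input) (arr : ℕ → ℕ → ℂ) {ρ : ℕ → ℕ} {n M a z : ℕ} (h0 : ρ 0 = n)
    (h3 : ρ 3 = M) (h7 : ρ 7 = a) (h9 : ρ 9 = z) (ha : a < M) :
    digitExpr.eval inp arr 10 ρ = digit n a z := by
  have hx : ∀ r, placeExpr.eval inp arr 11 (Function.update ρ 10 r) = ((n + 1) ^ z : ℕ) := fun r =>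
    placeExpr_eval inp arr (by simpa using h0) (by simpa using h9) (by norm_num)
  rw [← digit_eq]
  simp only [digitExpr, NumExpr.eval, h0]
  rw [quotExpr_eval inp arr h3 h7 ha (by positivity) hx,
    quotExpr_eval inp arr (B := (n + 1) ^ z * (n + 1)) h3 h7 ha (by positivity)]
  · simp
  · intro r
    simp [NumExpr.eval, hx, h0]

theorem digitExpr_cost {ρ : ℕ → ℕ} {M z : ℕ} (h3 : ρ 3 = M) (h9 : ρ 9 = z) :
    digitExpr.cost 10 ρ = 11 + M * (14 * z + 34) := by
  have h : ∀ r, placeExpr.cost 11 (Function.update ρ 10 r) = 3 + 7 * z :=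
    fun r => placeExpr_cost (by simpa using h9)
  simp [digitExpr, quotExpr, NumExpr.cost, h, h3]
  ring

theorem phaseExpr_eval (inp : Input) (arr : ℕ → ℕ → ℂ) {ρ : ℕ → ℕ} {n K a z : ℕ} (h0 : ρ 0 = n)
    (h2 : ρ 2 = K) (h7 : ρ 7 = a) (h9 : ρ 9 = z) (h : arr 3 (K * a + z) = digit n a z) :
    phaseExpr.eval inp arr 10 ρ = inp .root 0 0 ^ digit n a z := by
  have hd : digit n a z ≤ n := Nat.lt_succ_iff.1 (Nat.mod_lt _ (Nat.succ_pos n))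
  rw [← prod_ite_add_one_le hd]
  simp [phaseExpr, NumExpr.eval, NatExpr.eval, h0, h2, h7, h9, h]

theorem phaseExpr_cost {ρ : ℕ → ℕ} {n K : ℕ} (h0 : ρ 0 = n) (h2 : ρ 2 = K) :
    phaseExpr.cost 10 ρ = 3 + n * (24 + 2 * K) := by
  simp [phaseExpr, NumExpr.cost, NatExpr.cost, NatExpr.eval, h0, h2]
  ring_nf
  simp

theorem estimateExpr_eval (inp : Input) (arr : ℕ → ℕ → ℂ) {ρ : ℕ → ℕ} {n K N a : ℕ} (h0 : ρ 0 = n)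
    (h2 : ρ 2 = K) (h4 : ρ 4 = N) (h7 : ρ 7 = a) (H : ℕ → ℕ → ℕ → ℂ)
    (hH : ∀ i < n, ∀ j < n, ∀ z < K, arr 1 ((i * n + j) * K + z) = H i j z) (sg : ℕ → ℂ)
    (hsg : ∀ q < n * N, arr 2 q = sg q) (ω : ℂ)
    (hω : ∀ z < K, arr 4 (K * a + z) = ω ^ digit n a z) :
    estimateExpr.eval inp arr 10 ρ = estimate n K N sg H (inp .gram) ω a := by
  have hq : ∀ t < N, ∀ i < n, arr 2 (n * t + i) = sg (n * t + i) := fun t ht i hi => hsg _ (by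
    calc n * t + i < n * (t + 1) := by rw [mul_add]; omega
      _ ≤ n * N := Nat.mul_le_mul_left _ ht)
  simp only [estimateExpr, NumExpr.eval, NatExpr.eval, Function.update, h0, h2, h4, h7, estimate]
  simp
  congr 1
  refine Finset.sum_congr rfl fun t ht => Finset.prod_congr rfl fun i hi => ?_
  rw [Finset.mem_range] at ht hi
  rw [hq t ht i hi]
  congr 2
  refine Finset.sum_congr rfl fun j hj => ?_
  rw [Finset.mem_range] at hj
  rw [hq t ht j hj]
  congr 1
  refine Finset.sum_congr rfl fun z hz => ?_
  rw [Finset.mem_range] at hz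
  rw [hω z hz, mul_comm K, mul_comm n, hH i hi j hj z hz]

theorem estimateExpr_cost {ρ : ℕ → ℕ} {n K N : ℕ} (h0 : ρ 0 = n) (h2 : ρ 2 = K) (h4 : ρ 4 = N) :
    estimateExpr.cost 10 ρ
      = 13 + 2 * K + N * (15 + 2 * n + n * (29 + 2 * n + n * (31 + 21 * K))) := by
  simp [estimateExpr, NumExpr.cost, NatExpr.cost, NatExpr.eval, Function.update, h0, h2, h4]
  ring

theorem fourierExpr_eval (inp : Input) (arr : ℕ → ℕ → ℂ) {ρ : ℕ → ℕ} {n K b : ℕ} (h0 : ρ 0 = n)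
    (h2 : ρ 2 = K) (h3 : ρ 3 = (n + 1) ^ K) (h7 : ρ 7 = b) (ω : ℂ)
    (hd : ∀ z < K, arr 3 (K * b + z) = digit n b z)
    (hω : ∀ a < (n + 1) ^ K, ∀ z < K, arr 4 (K * a + z) = ω ^ digit n a z) (X : ℕ → ℂ)
    (hX : ∀ a < (n + 1) ^ K, arr 5 a = X a) :
    fourierExpr.eval inp arr 10 ρ = fourier n K ω X b := by
  simp only [fourierExpr, NumExpr.eval, NatExpr.eval, Function.update, h0, h2, h3, h7, fourier]
  simp
  congr 1
  refine Finset.sum_congr rfl fun a ha => ?_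
  rw [Finset.mem_range] at ha
  rw [hX a ha]
  congr 1
  refine Finset.prod_congr rfl fun z hz => ?_
  rw [Finset.mem_range] at hz
  have hd' : digit n b z ≤ n := Nat.lt_succ_iff.1 (Nat.mod_lt _ (Nat.succ_pos n))
  rw [← prod_ite_add_one_le hd', hd z hz, hω a ha z hz]
  simp

theorem fourierExpr_cost {ρ : ℕ → ℕ} {n K M : ℕ} (h0 : ρ 0 = n) (h2 : ρ 2 = K) (h3 : ρ 3 = M) :
    fourierExpr.cost 10 ρ = 5 + M * (11 + K * (7 + n * (34 + 4 * K))) := by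
  simp [fourierExpr, NumExpr.cost, NatExpr.cost, NatExpr.eval, Function.update, h0, h2, h3]
  ring

/-- A bound on the running time of the main phase, for `M` grid points and `N` samples. -/
def mainTime (n K M N : ℕ) : ℕ :=
  24 + 7 * K + M + N + n * N * 10 +
    (2 + M * (10 + K * (37 + 2 * K + M * (14 * K + 34)))) +
    (2 + M * (10 + K * (29 + 2 * K + n * (24 + 2 * K)))) +
    (2 + M * (51 + 2 * K + N * (15 + 2 * n + n * (29 + 2 * n + n * (31 + 21 * K))))) +
    (2 + M * (52 + 2 * (M * (11 + K * (7 + n * (34 + 4 * K))))))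

theorem withIndices_of_lt (ρ : ℕ → ℕ) {l r : ℕ} (i j k : ℕ) (h : r < l) :
    withIndices ρ l i j k r = ρ r := by
  have h1 : r ≠ l + 1 := by omega
  have h2 : r ≠ l + 2 := by omega
  simp [withIndices, h.ne, h1, h2]

theorem mainProg_spec (K c n : ℕ) (inp : Input) (coin : ℕ → Bool) (s : Config) (hn : s.nat 0 = n)
    (hu : s.used = 0) (H : ℕ → ℕ → ℕ → ℂ)
    (hH : ∀ i < n, ∀ j < n, ∀ z < K, s.arr 1 ((i * n + j) * K + z) = H i j z) (N : ℕ)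
    (hN : ⌈(c * ((n + 1) ^ K : ℕ) / (inp .accuracy 0 0 * inp .accuracy 0 0)).re⌉₊ = N) :
    let s' := (mainProg K c).exec inp coin s
    (∀ b < (n + 1) ^ K, s'.arr 0 b = ((fourier n K (inp .root 0 0)
      (estimate n K N (fun q => coinSign (coin q)) H (inp .gram) (inp .root 0 0)) b).re : ℂ)) ∧
    s'.time ≤ s.time + mainTime n K ((n + 1) ^ K) N := by
  intro s'
  have hs' : s' = (fill 0 3 5 5 7 (.div (.add fourierExpr (.conjugate fourierExpr))
      (.const 2))).exec inp coin ((fill 5 3 5 5 7 estimateExpr).exec inp coin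
      ((fill 4 3 5 2 7 phaseExpr).exec inp coin ((fill 3 3 5 2 7 digitExpr).exec inp coin
      ((tossSigns 2 6 7).exec inp coin
      ((assignNat 6 7 (.mul (.cast 0) (.cast 4))).exec inp coin
      ((((assignNat 4 7 (samplesExpr c)).exec inp coin ((assignNat 3 7 gridExpr).exec inp coin
      ((s.setNat 2 K).tick 1))).setNat 5 1).tick 1)))))) := by
    simp only [s', mainProg, Prog.exec]
  rw [hs']
  clear hs' s'
  set M := (n + 1) ^ K with hM
  set ω := inp .root 0 0 with hω
  set sg : ℕ → ℂ := fun q => coinSign (coin q) with hsg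
  set X := estimate n K N sg H (inp .gram) ω with hX
  set s1 : Config := (s.setNat 2 K).tick 1 with hs1
  have a0 : s1.nat 0 = n := by simp [hs1, Config.tick, Config.setNat, hn]
  have a2 : s1.nat 2 = K := by simp [hs1, Config.tick, Config.setNat]
  have at1 : s1.time = s.time + 1 := rfl
  have au : s1.used = 0 := hu
  have aa : s1.arr = s.arr := rfl
  clear_value s1
  obtain ⟨bn, ba, bu, bt⟩ := assignNat_spec inp coin (r := 3) (l := 7) (e := gridExpr)
    (by simp [gridExpr, NumExpr.Below]) s1 (x := M) (by
      have : gridExpr.eval inp s1.arr 7 s1.nat = (M : ℕ) := by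
        simp [gridExpr, NumExpr.eval, a0, a2, hM]
      rw [this, Complex.natCast_re, Nat.ceil_natCast])
  have b0 := (bn 0 (by norm_num)).trans (show _ = n by simpa using a0)
  have b2 := (bn 2 (by norm_num)).trans (show _ = K by simpa using a2)
  have b3 := (bn 3 (by norm_num)).trans (show _ = M by simp)
  have bc : gridExpr.cost 7 s1.nat = 3 + 7 * K := by
    simp [gridExpr, NumExpr.cost, a2, mul_comm]
  rw [bc] at bt
  set s2 := (assignNat 3 7 gridExpr).exec inp coin s1 with hs2
  obtain ⟨cn, ca, cu, ct⟩ := assignNat_spec inp coin (r := 4) (l := 7) (e := samplesExpr c)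
    (by simp [samplesExpr, NumExpr.Below, NatExpr.Below]) s2 (x := N) (by
      rw [← hN]
      simp [samplesExpr, NumExpr.eval, NatExpr.eval, b3])
  have c0 := (cn 0 (by norm_num)).trans (show _ = n by simpa using b0)
  have c2 := (cn 2 (by norm_num)).trans (show _ = K by simpa using b2)
  have c3 := (cn 3 (by norm_num)).trans (show _ = M by simpa using b3)
  have c4 := (cn 4 (by norm_num)).trans (show _ = N by simp)
  have cc : (samplesExpr c).cost 7 s2.nat = 11 := by
    simp [samplesExpr, NumExpr.cost, NatExpr.cost]
  rw [cc] at ct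
  set s3 := (assignNat 4 7 (samplesExpr c)).exec inp coin s2
  set s4 : Config := (s3.setNat 5 1).tick 1 with hs4
  have d0 : s4.nat 0 = n := by simp [hs4, Config.tick, Config.setNat, c0]
  have d2 : s4.nat 2 = K := by simp [hs4, Config.tick, Config.setNat, c2]
  have d3 : s4.nat 3 = M := by simp [hs4, Config.tick, Config.setNat, c3]
  have d4 : s4.nat 4 = N := by simp [hs4, Config.tick, Config.setNat, c4]
  have d5 : s4.nat 5 = 1 := by simp [hs4, Config.tick, Config.setNat]
  have dt : s4.time = s3.time + 1 := rfl
  have du : s4.used = 0 := (cu.trans bu).trans au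
  have da : s4.arr = s.arr := (ca.trans ba).trans aa
  clear_value s4
  obtain ⟨en, ea, eu, et⟩ := assignNat_spec inp coin (r := 6) (l := 7)
    (e := .mul (.cast 0) (.cast 4)) (by simp [NumExpr.Below]) s4 (x := n * N) (by
      have : NumExpr.eval inp s4.arr (.mul (.cast 0) (.cast 4)) 7 s4.nat = (n * N : ℕ) := by
        simp [NumExpr.eval, d0, d4]
      rw [this, Complex.natCast_re, Nat.ceil_natCast])
  have ec : NumExpr.cost (.mul (.cast 0) (.cast 4)) 7 s4.nat = 3 := by simp [NumExpr.cost]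
  rw [ec] at et
  have e0 := (en 0 (by norm_num)).trans (show _ = n by simpa using d0)
  have e2 := (en 2 (by norm_num)).trans (show _ = K by simpa using d2)
  have e3 := (en 3 (by norm_num)).trans (show _ = M by simpa using d3)
  have e4 := (en 4 (by norm_num)).trans (show _ = N by simpa using d4)
  have e5 := (en 5 (by norm_num)).trans (show _ = 1 by simpa using d5)
  have e6 := (en 6 (by norm_num)).trans (show _ = n * N by simp)
  set s5 := (assignNat 6 7 (.mul (.cast 0) (.cast 4))).exec inp coin s4
  clear_value s5
  obtain ⟨fn, fa, fv, ft⟩ := tossSigns_spec inp coin (A := 2) (r := 6) (l := 7) (by norm_num) s5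
    (eu.trans du)
  rw [e6] at fv ft
  set s6 := (tossSigns 2 6 7).exec inp coin s5
  clear_value s6
  have f0 := (fn 0 (by norm_num)).trans e0
  have f2 := (fn 2 (by norm_num)).trans e2
  have f3 := (fn 3 (by norm_num)).trans e3
  have f4 := (fn 4 (by norm_num)).trans e4
  have f5 := (fn 5 (by norm_num)).trans e5
  have fH : ∀ i < n, ∀ j < n, ∀ z < K, s6.arr 1 ((i * n + j) * K + z) = H i j z := by
    intro i hi j hj z hz
    rw [fa 1 (by norm_num), ea, da, hH i hi j hj z hz]
  obtain ⟨gn, -, ga, gv, gt⟩ := fill_spec inp coin (A := 3) (r₁ := 3) (r₂ := 5) (r₃ := 2) (l := 7)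
    (e := digitExpr) (by norm_num) (by norm_num) (by norm_num)
    (by simp [digitExpr, quotExpr, placeExpr, NumExpr.Below]) s6 f3 f5 f2
    (fun a _ z => (digit n a z : ℂ)) (11 + M * (14 * K + 34))
    (fun arr _ a ha j _ z _ => digitExpr_eval inp arr
      (by simpa [withIndices_of_lt] using f0) (by simpa [withIndices_of_lt] using f3)
      (by simp [withIndices]) (by simp [withIndices]) ha)
    (fun a ha j _ z hz => by
      rw [digitExpr_cost (M := M) (z := z) (by simpa [withIndices_of_lt] using f3)
        (by simp [withIndices])]
      gcongr)
  set s7 := (fill 3 3 5 2 7 digitExpr).exec inp coin s6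
  clear_value s7
  have g0 := (gn 0 (by norm_num)).trans f0
  have g2 := (gn 2 (by norm_num)).trans f2
  have g3 := (gn 3 (by norm_num)).trans f3
  have g4 := (gn 4 (by norm_num)).trans f4
  have g5 := (gn 5 (by norm_num)).trans f5
  have gd : ∀ a < M, ∀ z < K, s7.arr 3 (K * a + z) = digit n a z := by
    intro a ha z hz
    have := gv a ha 0 one_pos z hz
    rwa [mul_one, add_zero, mul_comm a] at this
  obtain ⟨hn', -, ha, hv, ht⟩ := fill_spec inp coin (A := 4) (r₁ := 3) (r₂ := 5) (r₃ := 2) (l := 7)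
    (e := phaseExpr) (by norm_num) (by norm_num) (by norm_num)
    (by simp [phaseExpr, NumExpr.Below, NatExpr.Below]) s7 g3 g5 g2
    (fun a _ z => ω ^ digit n a z) (3 + n * (24 + 2 * K))
    (fun arr harr a ha j _ z hz => phaseExpr_eval inp arr
      (by simpa [withIndices_of_lt] using g0) (by simpa [withIndices_of_lt] using g2)
      (by simp [withIndices]) (by simp [withIndices])
      (by rw [harr 3 (by norm_num), gd a ha z hz]))
    (fun a ha j _ z hz => (phaseExpr_cost (by simpa [withIndices_of_lt] using g0)
      (by simpa [withIndices_of_lt] using g2)).le)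
  set s8 := (fill 4 3 5 2 7 phaseExpr).exec inp coin s7
  clear_value s8
  have h0 := (hn' 0 (by norm_num)).trans g0
  have h2 := (hn' 2 (by norm_num)).trans g2
  have h3 := (hn' 3 (by norm_num)).trans g3
  have h4 := (hn' 4 (by norm_num)).trans g4
  have h5 := (hn' 5 (by norm_num)).trans g5
  have hph : ∀ a < M, ∀ z < K, s8.arr 4 (K * a + z) = ω ^ digit n a z := by
    intro a ha z hz
    have := hv a ha 0 one_pos z hz
    rwa [mul_one, add_zero, mul_comm a] at this
  obtain ⟨in', -, ia, iv, it⟩ := fill_spec inp coin (A := 5) (r₁ := 3) (r₂ := 5) (r₃ := 5) (l := 7)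
    (e := estimateExpr) (by norm_num) (by norm_num) (by norm_num)
    (by simp [estimateExpr, NumExpr.Below, NatExpr.Below]) s8 h3 h5 h5
    (fun a _ _ => X a)
    (13 + 2 * K + N * (15 + 2 * n + n * (29 + 2 * n + n * (31 + 21 * K))))
    (fun arr harr a ham j _ z hz => estimateExpr_eval inp arr
      (by simpa [withIndices_of_lt] using h0) (by simpa [withIndices_of_lt] using h2)
      (by simpa [withIndices_of_lt] using h4) (by simp [withIndices]) H
      (fun i hi j hj z hz => by
        rw [harr 1 (by norm_num), ha 1 (by norm_num), ga 1 (by norm_num), fH i hi j hj z hz]) sg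
      (fun q hq => by
        rw [harr 2 (by norm_num), ha 2 (by norm_num), ga 2 (by norm_num), fv q hq]) ω
      (fun z hz => by rw [harr 4 (by norm_num), hph a ham z hz]))
    (fun a ha j _ z hz => (estimateExpr_cost (by simpa [withIndices_of_lt] using h0)
      (by simpa [withIndices_of_lt] using h2) (by simpa [withIndices_of_lt] using h4)).le)
  set s9 := (fill 5 3 5 5 7 estimateExpr).exec inp coin s8
  clear_value s9
  have i0 := (in' 0 (by norm_num)).trans h0
  have i2 := (in' 2 (by norm_num)).trans h2
  have i3 := (in' 3 (by norm_num)).trans h3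
  have i5 := (in' 5 (by norm_num)).trans h5
  obtain ⟨-, -, -, jv, jt⟩ := fill_spec inp coin (A := 0) (r₁ := 3) (r₂ := 5) (r₃ := 5) (l := 7)
    (e := .div (.add fourierExpr (.conjugate fourierExpr)) (.const 2))
    (by norm_num) (by norm_num) (by norm_num)
    (by simp [fourierExpr, NumExpr.Below, NatExpr.Below]) s9 i3 i5 i5
    (fun b _ _ => ((fourier n K ω X b).re : ℂ))
    (14 + 2 * (M * (11 + K * (7 + n * (34 + 4 * K)))))
    (fun arr harr b hb j _ z _ => by
      have : fourierExpr.eval inp arr (7 + 3) (withIndices s9.nat 7 b j z) = fourier n K ω X b :=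
        fourierExpr_eval inp arr
        (by simpa [withIndices_of_lt] using i0) (by simpa [withIndices_of_lt] using i2)
        (by simpa [withIndices_of_lt] using i3) (by simp [withIndices]) ω
        (fun z hz => by
          rw [harr 3 (by norm_num), ia 3 (by norm_num), ha 3 (by norm_num), gd b hb z hz])
        (fun a ham z hz => by
          rw [harr 4 (by norm_num), ia 4 (by norm_num), hph a ham z hz]) X
        (fun a ham => by
          have := iv a ham 0 one_pos 0 one_pos
          simp only [mul_one, add_zero] at this
          rw [harr 5 (by norm_num), this])
      simp only [NumExpr.eval, this, Complex.add_conj, Int.cast_ofNat]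
      push_cast
      ring)
    (fun b hb j _ z _ => by
      simp only [NumExpr.cost]
      rw [fourierExpr_cost (n := n) (K := K) (M := M) (by simpa [withIndices_of_lt] using i0)
        (by simpa [withIndices_of_lt] using i2) (by simpa [withIndices_of_lt] using i3)]
      omega)
  refine ⟨fun b hb => ?_, ?_⟩
  · simpa using jv b hb 0 one_pos 0 one_pos
  · refine jt.trans ?_
    rw [mainTime]
    linarith

/-! ### Amplitudes of photons in given single-particle states -/

section Amplitudes

variable {M : Type*}

/-- The occupation numbers when particle `j` is in mode `f j`. -/
def occ {n : ℕ} (f : Fin n → M) : M →₀ ℕ := ∑ j, Finsupp.single (f j) 1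

open Classical in
theorem occ_apply {n : ℕ} (f : Fin n → M) (i : M) : occ f i = Fintype.card {j // f j = i} := by
  simp [occ, Finsupp.finsetSum_apply, Finsupp.single_apply, Fintype.card_subtype]

theorem creation_single (i : M) (N : M →₀ ℕ) (c : ℂ) :
    creation i (Finsupp.single N c)
      = Finsupp.single (N + Finsupp.single i 1) (c * (Real.sqrt (N i + 1) : ℝ)) := by
  classical
  simp [creation, LinearMap.toSpanSingleton]

/-- The product of the factorials of the occupation numbers. -/
def occFactorial [Fintype M] (N : M →₀ ℕ) : ℕ := ∏ i, (N i).factorial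

open Classical in
theorem occFactorial_add_single [Fintype M] (N : M →₀ ℕ) (i : M) :
    occFactorial (N + Finsupp.single i 1) = occFactorial N * (N i + 1) := by
  unfold occFactorial
  rw [← Finset.mul_prod_erase _ _ (Finset.mem_univ i),
    ← Finset.mul_prod_erase _ (fun i => (N i).factorial) (Finset.mem_univ i)]
  have : ∏ x ∈ Finset.univ.erase i, ((N + Finsupp.single i 1 : M →₀ ℕ) x).factorial
      = ∏ x ∈ Finset.univ.erase i, (N x).factorial := by
    refine Finset.prod_congr rfl fun x hx => ?_
    rw [Finsupp.add_apply, Finsupp.single_eq_of_ne (Finset.ne_of_mem_erase hx), add_zero]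
  rw [this, Finsupp.add_apply, Finsupp.single_eq_same, Nat.factorial_succ]
  ring

theorem sum_fin_succ_fun {X A : Type*} [Fintype X] [AddCommMonoid A] {n : ℕ}
    (F : (Fin (n + 1) → X) → A) :
    ∑ f, F f = ∑ x, ∑ f : Fin n → X, F (Fin.cons x f) := by
  rw [← Fintype.sum_prod_type' (f := fun x (f : Fin n → X) => F (Fin.cons x f))]
  exact (Equiv.sum_comp (Fin.consEquiv fun _ : Fin (n + 1) => X) F).symm

/-- The state with one particle in each of the single-particle states `v j`, expanded into the
assignments `f` of modes to particles. -/
theorem prod_creation_vacuum [Fintype M] {n : ℕ} (v : Fin n → M → ℂ) :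
    (List.ofFn fun j => ∑ i, v j i • creation i).prod (vacuum M)
      = ∑ f : Fin n → M, Finsupp.single (occ f)
          ((∏ j, v j (f j)) * (Real.sqrt (occFactorial (occ f)) : ℝ)) := by
  induction n with
  | zero =>
    simp [vacuum, occ, occFactorial]
  | succ n ih =>
    rw [List.ofFn_succ, List.prod_cons, Module.End.mul_apply, ih]
    rw [sum_fin_succ_fun]
    rw [map_sum]
    simp only [LinearMap.coe_sum, Finset.sum_apply, LinearMap.smul_apply, creation_single]
    rw [Finset.sum_comm]
    refine Finset.sum_congr rfl fun i _ => ?_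
    refine Finset.sum_congr rfl fun f _ => ?_
    have h : occ (Fin.cons i f : Fin (n + 1) → M) = occ f + Finsupp.single i 1 := by
      simp [occ, Fin.sum_univ_succ, add_comm]
    rw [h, occFactorial_add_single, Finsupp.smul_single]
    congr 1
    simp only [Fin.prod_univ_succ, Fin.cons_zero, Fin.cons_succ,
      smul_eq_mul]
    push_cast
    rw [Real.sqrt_mul (by positivity)]
    push_cast
    ring

open Classical in
theorem exists_perm_of_occ_eq {n : ℕ} {f g : Fin n → M} (h : occ f = occ g) :
    ∃ σ : Equiv.Perm (Fin n), g ∘ σ = f := by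
  have hc : ∀ i, Fintype.card {j // f j = i} = Fintype.card {j // g j = i} := fun i => by
    rw [← occ_apply, ← occ_apply, h]
  refine ⟨Equiv.ofFiberEquiv (f := f) (g := g) fun i => Fintype.equivOfCardEq (hc i), ?_⟩
  ext j
  exact Equiv.ofFiberEquiv_map _ j

theorem occ_comp_perm {n : ℕ} (g : Fin n → M) (σ : Equiv.Perm (Fin n)) : occ (g ∘ σ) = occ g :=
  Equiv.sum_comp σ fun j => Finsupp.single (g j) 1

open Classical in
/-- The number of permutations that carry one assignment to another. -/
theorem card_perm_comp_eq [Fintype M] {n : ℕ} (f g : Fin n → M) :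
    (Finset.univ.filter fun σ : Equiv.Perm (Fin n) => g ∘ σ = f).card
      = if occ f = occ g then occFactorial (occ g) else 0 := by
  split_ifs with h
  · obtain ⟨τ, rfl⟩ := exists_perm_of_occ_eq h
    have h1 : occFactorial (occ g) = Fintype.card {σ : Equiv.Perm (Fin n) // g ∘ σ = g} := by
      rw [DomMulAct.stabilizer_card]
      exact Finset.prod_congr rfl fun i _ => by rw [occ_apply]
    rw [h1, Fintype.card_subtype]
    refine Finset.card_bij (fun σ _ => σ * τ⁻¹) ?_ ?_ ?_
    · intro σ hσ
      rw [Finset.mem_filter] at hσ ⊢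
      refine ⟨Finset.mem_univ _, ?_⟩
      ext j
      have := congrFun hσ.2 (τ⁻¹ j)
      simpa using this
    · intro σ _ σ' _ h
      simpa using h
    · intro σ hσ
      rw [Finset.mem_filter] at hσ
      refine ⟨σ * τ, ?_, by simp⟩
      rw [Finset.mem_filter]
      refine ⟨Finset.mem_univ _, ?_⟩
      ext j
      exact congrFun hσ.2 (τ j)
  · rw [Finset.card_eq_zero, Finset.filter_eq_empty_iff]
    intro σ _ hσ
    exact h (by rw [← hσ, occ_comp_perm])

open Classical in
/-- The sum over permutations of a quantity that depends on the permuted assignment only. -/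
theorem sum_perm_comp [Fintype M] {n : ℕ} (g : Fin n → M) (F : (Fin n → M) → ℂ) :
    ∑ σ : Equiv.Perm (Fin n), F (g ∘ σ)
      = ∑ f, if occ f = occ g then (occFactorial (occ g) : ℂ) * F f else 0 := by
  rw [← Finset.sum_fiberwise (s := Finset.univ) (g := fun σ : Equiv.Perm (Fin n) => g ∘ σ)]
  refine Finset.sum_congr rfl fun f _ => ?_
  rw [Finset.sum_congr rfl (g := fun _ => F f) fun σ hσ => by rw [(Finset.mem_filter.1 hσ).2],
    Finset.sum_const, card_perm_comp_eq, nsmul_eq_mul]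
  split_ifs <;> simp

open Classical in
theorem prod_creation_vacuum_apply [Fintype M] {n : ℕ} (v : Fin n → M → ℂ) (N : M →₀ ℕ) :
    (List.ofFn fun j => ∑ i, v j i • creation i).prod (vacuum M) N
      = (Real.sqrt (occFactorial N) : ℝ) *
        ∑ f : Fin n → M, if occ f = N then ∏ j, v j (f j) else 0 := by
  rw [prod_creation_vacuum, Finsupp.finsetSum_apply, Finset.mul_sum]
  refine Finset.sum_congr rfl fun f _ => ?_
  rw [Finsupp.single_apply]
  split_ifs with h
  · rw [h, mul_comm]
  · simp

/-- In the state with one particle in each of the single-particle states `v j`, the generating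
function of the occupation numbers at the point `D` is the permanent of the matrix of the scalar
products `⟨v i, D v j⟩`. -/
theorem sum_norm_sq_mul_prod_pow [Fintype M] {n : ℕ} (v : Fin n → M → ℂ) (D : M → ℂ) :
    let ψ := (List.ofFn fun j => ∑ i, v j i • creation i).prod (vacuum M)
    ∑ N ∈ ψ.support, ((‖ψ N‖ ^ 2 : ℝ) : ℂ) * ∏ i, D i ^ N i
      = (Matrix.of fun i j => ∑ k, conj (v i k) * D k * v j k).permanent := by
  classical
  intro ψ
  have hψ : ∀ N, ψ N = (Real.sqrt (occFactorial N) : ℝ) *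
      ∑ f : Fin n → M, if occ f = N then ∏ j, v j (f j) else 0 := prod_creation_vacuum_apply v
  clear_value ψ
  set T : Finset (M →₀ ℕ) := Finset.univ.image (occ : (Fin n → M) → _) with hT
  have hsub : ψ.support ⊆ T := by
    intro N hN
    rw [Finsupp.mem_support_iff, hψ] at hN
    obtain ⟨f, -, hf⟩ := Finset.exists_ne_zero_of_sum_ne_zero (right_ne_zero_of_mul hN)
    have : occ f = N := by
      by_contra h
      simp [h] at hf
    exact Finset.mem_image.2 ⟨f, Finset.mem_univ _, this⟩
  rw [Finset.sum_subset hsub fun N _ hN => by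
    rw [Finsupp.notMem_support_iff.1 hN]; simp]
  have hD : ∀ g : Fin n → M, ∏ i, D i ^ occ g i = ∏ j, D (g j) := by
    intro g
    rw [← Finset.prod_fiberwise (s := Finset.univ) (g := g)]
    refine Finset.prod_congr rfl fun i _ => ?_
    rw [occ_apply, Fintype.card_subtype, Finset.prod_congr rfl
      (g := fun _ => D i) fun j hj => by rw [(Finset.mem_filter.1 hj).2], Finset.prod_const]
  have h1 : ∀ N, ((‖ψ N‖ ^ 2 : ℝ) : ℂ) * ∏ i, D i ^ N i
      = ∑ g : Fin n → M, if occ g = N then ∑ f : Fin n → M, if occ f = occ g then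
        (occFactorial (occ g) : ℂ) * (∏ j, conj (v j (f j))) * ((∏ j, D (g j)) * ∏ j, v j (g j))
        else 0 else 0 := by
    intro N
    have hn : ((‖ψ N‖ ^ 2 : ℝ) : ℂ) = conj (ψ N) * ψ N := by
      rw [mul_comm, Complex.mul_conj, Complex.normSq_eq_norm_sq]
    rw [hn, hψ]
    have hs : ((Real.sqrt (occFactorial N) : ℝ) : ℂ) * (Real.sqrt (occFactorial N) : ℝ)
        = occFactorial N := by
      rw [← Complex.ofReal_mul, Real.mul_self_sqrt (by positivity), Complex.ofReal_natCast]
    rw [map_mul, Complex.conj_ofReal, map_sum]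
    calc _ = ((Real.sqrt (occFactorial N) : ℝ) * (Real.sqrt (occFactorial N) : ℝ)) *
          ((∑ g : Fin n → M, if occ g = N then ∏ j, v j (g j) else 0) *
          ∑ f : Fin n → M, conj (if occ f = N then ∏ j, v j (f j) else 0)) * ∏ i, D i ^ N i := by
            ring
      _ = _ := by
        rw [hs, Finset.sum_mul, Finset.mul_sum, Finset.sum_mul]
        refine Finset.sum_congr rfl fun g _ => ?_
        split_ifs with hg
        · subst hg
          rw [hD, Finset.mul_sum, Finset.mul_sum, Finset.sum_mul]
          refine Finset.sum_congr rfl fun f _ => ?_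
          split_ifs
          · rw [map_prod]; ring
          · simp
        · simp
  rw [Finset.sum_congr rfl fun N _ => h1 N, Finset.sum_comm]
  have h2 : ∀ g : Fin n → M, ∑ N ∈ T, (if occ g = N then ∑ f : Fin n → M, if occ f = occ g then
        (occFactorial (occ g) : ℂ) * (∏ j, conj (v j (f j))) * ((∏ j, D (g j)) * ∏ j, v j (g j))
        else 0 else 0)
      = ∑ σ : Equiv.Perm (Fin n), ∏ j, (conj (v (σ j) (g j)) * D (g j) * v j (g j)) := by
    intro g
    rw [Finset.sum_ite_eq, if_pos (Finset.mem_image_of_mem _ (Finset.mem_univ g))]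
    have := sum_perm_comp g fun f => (∏ j, conj (v j (f j))) * ((∏ j, D (g j)) * ∏ j, v j (g j))
    simp only [← mul_assoc] at this ⊢
    rw [← this, ← Equiv.sum_comp (Equiv.inv (Equiv.Perm (Fin n)))]
    refine Finset.sum_congr rfl fun σ _ => ?_
    rw [Finset.prod_mul_distrib, Finset.prod_mul_distrib]
    congr 2
    rw [← Equiv.prod_comp σ]
    exact Finset.prod_congr rfl fun j _ => by simp
  rw [Finset.sum_congr rfl fun g _ => h2 g, Finset.sum_comm, Matrix.permanent]
  refine Finset.sum_congr rfl fun σ _ => ?_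
  simp only [Matrix.of_apply]
  rw [Finset.prod_univ_sum, Fintype.piFinset_univ]

end Amplitudes

/-! ### The characteristic function of the binned photon numbers -/

section CharacteristicFunction

variable {E ι : Type*} [NormedAddCommGroup E] [InnerProductSpace ℂ E] [Fintype ι] {n m K : ℕ}

/-- The single-particle state in which photon `j` leaves the interferometer. -/
def amplitude (h : n ≤ m) (U : Matrix (Fin m) (Fin m) ℂ) (φ : Fin n → E) (Φ : ι → E) (j : Fin n)
    (p : Fin m × ι) : ℂ :=
  U (Fin.castLE h j) p.1 * inner ℂ (Φ p.2) (φ j)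

theorem outputState_eq (h : n ≤ m) (U : Matrix (Fin m) (Fin m) ℂ) (φ : Fin n → E) (Φ : ι → E) :
    outputState h U φ Φ = (List.ofFn fun j => ∑ p, amplitude h U φ Φ j p • creation p).prod
      (vacuum (Fin m × ι)) := by
  unfold outputState
  congr 3
  ext1 j
  rw [Fintype.sum_prod_type]
  refine Finset.sum_congr rfl fun k _ => ?_
  rw [creationIn, Finset.smul_sum]
  exact Finset.sum_congr rfl fun a _ => by rw [amplitude, mul_smul]

/-- The phase that a photon in spatial mode `k` contributes, when bin `z` is given the weight
`w z`. -/
def binWeight (𝒦 : Fin K → Finset (Fin m)) (w : Fin K → ℂ) (k : Fin m) : ℂ :=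
  ∏ z, if k ∈ 𝒦 z then w z else 1

theorem prod_binWeight_pow (𝒦 : Fin K → Finset (Fin m)) (w : Fin K → ℂ) (N : Fin m × ι →₀ ℕ) :
    ∏ p : Fin m × ι, binWeight 𝒦 w p.1 ^ N p = ∏ z, w z ^ photonsIn (𝒦 z) N := by
  simp only [binWeight, ← Finset.prod_pow]
  rw [Finset.prod_comm]
  refine Finset.prod_congr rfl fun z _ => ?_
  rw [Fintype.prod_prod_type, photonsIn, ← Finset.prod_pow_eq_pow_sum]
  simp only [← Finset.prod_pow_eq_pow_sum]
  rw [← Finset.prod_subset (Finset.subset_univ (𝒦 z))]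
  · refine Finset.prod_congr rfl fun k hk => Finset.prod_congr rfl fun a _ => ?_
    rw [if_pos hk]
  · intro k _ hk
    simp [hk]

theorem photonsIn_le_of_mem_support {h : n ≤ m} {U : Matrix (Fin m) (Fin m) ℂ} {φ : Fin n → E}
    {Φ : ι → E} {N : Fin m × ι →₀ ℕ} (hN : N ∈ (outputState h U φ Φ).support)
    (A : Finset (Fin m)) : photonsIn A N ≤ n := by
  classical
  rw [outputState_eq, Finsupp.mem_support_iff, prod_creation_vacuum_apply] at hN
  obtain ⟨f, -, hf⟩ := Finset.exists_ne_zero_of_sum_ne_zero (right_ne_zero_of_mul hN)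
  have hfN : occ f = N := by
    by_contra h
    simp [h] at hf
  calc photonsIn A N ≤ ∑ k, ∑ a, N (k, a) :=
        Finset.sum_le_sum_of_subset (Finset.subset_univ A)
    _ = ∑ p, N p := (Fintype.sum_prod_type _).symm
    _ = ∑ p, ∑ j, (Finsupp.single (f j) 1 : _ →₀ ℕ) p := by
        simp only [← hfN, occ, Finsupp.finsetSum_apply]
    _ = n := by
        rw [Finset.sum_comm]
        simp [Finsupp.single_apply]

/-- The matrix whose permanent is the value of the characteristic function with weights `w`. -/
def charMatrix (h : n ≤ m) (U : Matrix (Fin m) (Fin m) ℂ) (φ : Fin n → E) (Φ : ι → E)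
    (𝒦 : Fin K → Finset (Fin m)) (w : Fin K → ℂ) : Matrix (Fin n) (Fin n) ℂ :=
  Matrix.of fun i j => ∑ p, conj (amplitude h U φ Φ i p) * binWeight 𝒦 w p.1 * amplitude h U φ Φ j p

theorem sum_binnedProb_mul_prod_pow (h : n ≤ m) (U : Matrix (Fin m) (Fin m) ℂ) (φ : Fin n → E)
    (Φ : ι → E) (𝒦 : Fin K → Finset (Fin m)) (w : Fin K → ℂ) :
    ∑ k : Fin K → Fin (n + 1), (binnedProb h U φ Φ 𝒦 (fun z => k z) : ℂ) * ∏ z, w z ^ (k z : ℕ)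
      = (charMatrix h U φ Φ 𝒦 w).permanent := by
  classical
  have key := sum_norm_sq_mul_prod_pow (amplitude h U φ Φ) fun p => binWeight 𝒦 w p.1
  simp only [← outputState_eq, prod_binWeight_pow] at key
  rw [charMatrix, ← key]
  set ψ := outputState h U φ Φ with hψ
  have hmaps : ∀ N ∈ ψ.support, (fun z => Fin.ofNat (n + 1) (photonsIn (𝒦 z) N))
      ∈ (Finset.univ : Finset (Fin K → Fin (n + 1))) := fun _ _ => Finset.mem_univ _
  rw [← Finset.sum_fiberwise_of_maps_to hmaps]
  refine Finset.sum_congr rfl fun k _ => ?_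
  rw [binnedProb, Complex.ofReal_sum, Finset.sum_mul]
  refine Finset.sum_congr ?_ ?_
  · ext N
    simp only [Finset.mem_filter, ← hψ]
    refine and_congr_right fun hN => ?_
    rw [funext_iff]
    refine forall_congr' fun z => ?_
    have := photonsIn_le_of_mem_support hN (𝒦 z)
    rw [Fin.ext_iff, Fin.val_ofNat, Nat.mod_eq_of_lt (by omega)]
  · intro N hN
    rw [Finset.mem_filter] at hN
    congr 1
    refine Finset.prod_congr rfl fun z _ => ?_
    have := photonsIn_le_of_mem_support hN.1 (𝒦 z)
    rw [← hN.2, Fin.val_ofNat, Nat.mod_eq_of_lt (by omega)]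

theorem sum_conj_inner_mul_inner {Φ : ι → E} (hΦ : Orthonormal ℂ Φ) {φ : Fin n → E}
    (hφ : ∀ j, ‖φ j‖ = 1) (hΦφ : ∀ j, ∑ a, ‖inner ℂ (Φ a) (φ j)‖ ^ 2 = 1) (i j : Fin n) :
    ∑ a, conj (inner ℂ (Φ a) (φ i)) * inner ℂ (Φ a) (φ j) = gram φ i j := by
  -- By Parseval's identity the part of `φ i` orthogonal to all `Φ a` vanishes.
  have hexp : ∀ i, φ i = ∑ a, (inner ℂ (Φ a) (φ i)) • Φ a := by
    intro i
    set ξ := ∑ a, (inner ℂ (Φ a) (φ i)) • Φ a with hξ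
    have h1 : inner ℂ (φ i) ξ = (1 : ℂ) := by
      rw [hξ, inner_sum, ← Complex.ofReal_one, ← hΦφ i, Complex.ofReal_sum]
      refine Finset.sum_congr rfl fun a _ => ?_
      rw [inner_smul_right, ← inner_conj_symm (φ i), Complex.mul_conj, Complex.normSq_eq_norm_sq]
    have h2 : inner ℂ ξ ξ = (1 : ℂ) := by
      rw [hξ, hΦ.inner_sum, ← Complex.ofReal_one, ← hΦφ i, Complex.ofReal_sum]
      refine Finset.sum_congr rfl fun a _ => ?_
      rw [mul_comm, Complex.mul_conj, Complex.normSq_eq_norm_sq]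
    have h3 : inner ℂ ξ (φ i) = (1 : ℂ) := by rw [← inner_conj_symm, h1, map_one]
    have h4 : inner ℂ (φ i) (φ i) = (1 : ℂ) := by
      rw [inner_self_eq_norm_sq_to_K, hφ i]; simp
    rw [← sub_eq_zero, ← inner_self_eq_zero (𝕜 := ℂ), inner_sub_left, inner_sub_right,
      inner_sub_right, h1, h2, h3, h4]
    ring
  rw [gram, Matrix.of_apply]
  conv_rhs => rw [hexp j, inner_sum]
  refine Finset.sum_congr rfl fun a _ => ?_
  rw [inner_smul_right, inner_conj_symm, mul_comm]

theorem gram_self {φ : Fin n → E} (hφ : ∀ j, ‖φ j‖ = 1) (i : Fin n) : gram φ i i = 1 := by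
  rw [gram, Matrix.of_apply, inner_self_eq_norm_sq_to_K, hφ i]
  simp

theorem sum_conj_mul_of_mem_unitaryGroup {U : Matrix (Fin m) (Fin m) ℂ}
    (hU : U ∈ Matrix.unitaryGroup (Fin m) ℂ) (i j : Fin m) :
    ∑ k, conj (U i k) * U j k = if i = j then 1 else 0 := by
  have := congrFun (congrFun (Matrix.mem_unitaryGroup_iff.1 hU) j) i
  rw [Matrix.mul_apply, Matrix.one_apply] at this
  simp only [Matrix.star_apply, RCLike.star_def] at this
  simp only [eq_comm (a := i), ← this, mul_comm]

variable {h : n ≤ m} {U : Matrix (Fin m) (Fin m) ℂ} {φ : Fin n → E} {Φ : ι → E}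

theorem sum_conj_amplitude_mul (hφ : ∀ j, ‖φ j‖ = 1) (hΦ : Orthonormal ℂ Φ)
    (hΦφ : ∀ j, ∑ a, ‖inner ℂ (Φ a) (φ j)‖ ^ 2 = 1) (D : Fin m → ℂ) (i j : Fin n) :
    ∑ p, conj (amplitude h U φ Φ i p) * D p.1 * amplitude h U φ Φ j p
      = (∑ k, D k * (conj (U (Fin.castLE h i) k) * U (Fin.castLE h j) k)) * gram φ i j := by
  rw [← sum_conj_inner_mul_inner hΦ hφ hΦφ, Finset.sum_mul_sum, Fintype.sum_prod_type]
  refine Finset.sum_congr rfl fun k _ => Finset.sum_congr rfl fun a _ => ?_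
  simp only [amplitude, map_mul]
  ring

theorem sum_conj_amplitude_mul_amplitude (hU : U ∈ Matrix.unitaryGroup (Fin m) ℂ)
    (hφ : ∀ j, ‖φ j‖ = 1) (hΦ : Orthonormal ℂ Φ)
    (hΦφ : ∀ j, ∑ a, ‖inner ℂ (Φ a) (φ j)‖ ^ 2 = 1) (i j : Fin n) :
    ∑ p, conj (amplitude h U φ Φ i p) * amplitude h U φ Φ j p = if i = j then 1 else 0 := by
  have := sum_conj_amplitude_mul (h := h) (U := U) hφ hΦ hΦφ (fun _ => 1) i j
  simp only [mul_one, one_mul, sum_conj_mul_of_mem_unitaryGroup hU] at this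
  rw [this]
  rcases eq_or_ne i j with rfl | hij
  · simp [gram_self hφ]
  · simp [hij]

/-- For disjoint bins the phase is affine in the weights. -/
theorem binWeight_eq {𝒦 : Fin K → Finset (Fin m)}
    (h𝒦 : Pairwise fun z z' => Disjoint (𝒦 z) (𝒦 z')) (w : Fin K → ℂ) (k : Fin m) :
    binWeight 𝒦 w k = 1 + ∑ z, (w z - 1) * if k ∈ 𝒦 z then 1 else 0 := by
  rw [binWeight]
  by_cases hk : ∃ z, k ∈ 𝒦 z
  · obtain ⟨z, hz⟩ := hk
    have hne : ∀ z', z' ≠ z → k ∉ 𝒦 z' := fun z' hz' hk' =>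
      Finset.disjoint_left.1 (h𝒦 hz') hk' hz
    rw [Fintype.prod_eq_single z fun z' hz' => if_neg (hne z' hz'), Fintype.sum_eq_single z
      fun z' hz' => by rw [if_neg (hne z' hz'), mul_zero]]
    simp [hz]
  · push Not at hk
    simp [hk]

theorem charMatrix_apply (hU : U ∈ Matrix.unitaryGroup (Fin m) ℂ)
    (hφ : ∀ j, ‖φ j‖ = 1) (hΦ : Orthonormal ℂ Φ)
    (hΦφ : ∀ j, ∑ a, ‖inner ℂ (Φ a) (φ j)‖ ^ 2 = 1) {𝒦 : Fin K → Finset (Fin m)}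
    (h𝒦 : Pairwise fun z z' => Disjoint (𝒦 z) (𝒦 z')) (w : Fin K → ℂ) (i j : Fin n) :
    charMatrix h U φ Φ 𝒦 w i j = (if i = j then 1 else 0) + gram φ i j *
      ∑ z, (w z - 1) * ∑ k, (if k ∈ 𝒦 z then 1 else 0) *
        (conj (U (Fin.castLE h i) k) * U (Fin.castLE h j) k) := by
  rw [charMatrix, Matrix.of_apply, sum_conj_amplitude_mul hφ hΦ hΦφ]
  simp only [binWeight_eq h𝒦, add_mul, one_mul, Finset.sum_add_distrib,
    sum_conj_mul_of_mem_unitaryGroup hU]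
  congr 1
  · rcases eq_or_ne i j with rfl | hij
    · simp [gram_self hφ]
    · simp [hij]
  · rw [mul_comm]
    congr 1
    simp only [Finset.sum_mul, Finset.mul_sum]
    rw [Finset.sum_comm]
    exact Finset.sum_congr rfl fun z _ => Finset.sum_congr rfl fun k _ => by ring

/-- Phases give a contraction: it is the compression of a diagonal unitary matrix to the space
spanned by the orthonormal single-particle states. -/
theorem sum_norm_sq_charMatrix_le (hU : U ∈ Matrix.unitaryGroup (Fin m) ℂ)
    (hφ : ∀ j, ‖φ j‖ = 1) (hΦ : Orthonormal ℂ Φ)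
    (hΦφ : ∀ j, ∑ a, ‖inner ℂ (Φ a) (φ j)‖ ^ 2 = 1) (𝒦 : Fin K → Finset (Fin m))
    {w : Fin K → ℂ} (hw : ∀ z, ‖w z‖ = 1) (x : Fin n → ℂ) :
    ∑ i, ‖∑ j, charMatrix h U φ Φ 𝒦 w i j * x j‖ ^ 2 ≤ ∑ j, ‖x j‖ ^ 2 := by
  set v := amplitude h U φ Φ with hv
  have horth : ∀ i j, ∑ p, conj (v i p) * v j p = if i = j then 1 else 0 :=
    sum_conj_amplitude_mul_amplitude hU hφ hΦ hΦφ
  set e : Fin n → EuclideanSpace ℂ (Fin m × ι) := fun i => WithLp.toLp 2 (v i) with he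
  have hon : Orthonormal ℂ e := by
    rw [orthonormal_iff_ite]
    intro i j
    rw [← horth i j, he, PiLp.inner_apply]
    exact Finset.sum_congr rfl fun p _ => by simp [mul_comm]
  set y : EuclideanSpace ℂ (Fin m × ι) :=
    WithLp.toLp 2 fun p => binWeight 𝒦 w p.1 * ∑ j, x j * v j p with hy
  have hbessel := hon.sum_inner_products_le (s := Finset.univ) (x := y)
  have hD : ∀ k, ‖binWeight 𝒦 w k‖ = 1 := by
    intro k
    rw [binWeight, norm_prod]
    refine Finset.prod_eq_one fun z _ => ?_
    split_ifs
    · exact hw z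
    · exact norm_one
  have hL : ∀ i, inner ℂ (e i) y = ∑ j, charMatrix h U φ Φ 𝒦 w i j * x j := by
    intro i
    rw [he, hy, PiLp.inner_apply]
    simp only [charMatrix, Matrix.of_apply, Finset.sum_mul, ← hv]
    rw [Finset.sum_comm]
    refine Finset.sum_congr rfl fun p _ => ?_
    simp only [RCLike.inner_apply, Finset.mul_sum, Finset.sum_mul]
    exact Finset.sum_congr rfl fun j _ => by ring
  have hR : ‖y‖ ^ 2 = ∑ j, ‖x j‖ ^ 2 := by
    rw [EuclideanSpace.norm_sq_eq]
    simp only [hy, norm_mul, hD, one_mul]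
    have hsq : ∀ z : ℂ, ((‖z‖ ^ 2 : ℝ) : ℂ) = conj z * z := fun z => by
      rw [mul_comm, Complex.mul_conj, Complex.normSq_eq_norm_sq]
    rw [← Complex.ofReal_inj, Complex.ofReal_sum, Complex.ofReal_sum]
    simp only [hsq, map_sum, map_mul, Finset.sum_mul_sum]
    rw [Finset.sum_comm]
    refine Finset.sum_congr rfl fun i _ => ?_
    rw [Finset.sum_comm]
    have : ∀ j, ∑ p, conj (x i) * conj (v i p) * (x j * v j p)
        = conj (x i) * x j * if i = j then 1 else 0 := by
      intro j
      rw [← horth i j, Finset.mul_sum]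
      exact Finset.sum_congr rfl fun p _ => by ring
    simp [this]
  rw [hR] at hbessel
  simpa only [hL] using hbessel

end CharacteristicFunction

/-! ### Glynn's estimator for permanents -/

section Glynn

variable {n : ℕ}

/-- Glynn's estimator for the permanent of `A`, for a given outcome of the coins. -/
def glynn (A : Matrix (Fin n) (Fin n) ℂ) (b : Fin n → Bool) : ℂ :=
  ∏ i, coinSign (b i) * ∑ j, A i j * coinSign (b j)

theorem coinSign_mul_self (b : Bool) : coinSign b * coinSign b = 1 := by
  cases b <;> simp [coinSign]

theorem coinSign_not (b : Bool) : coinSign (!b) = -coinSign b := by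
  cases b <;> simp [coinSign]

theorem norm_coinSign (b : Bool) : ‖coinSign b‖ = 1 := by
  cases b <;> simp [coinSign]

theorem sum_prod_coinSign_eq_zero {f : Fin n → Fin n} (hf : ¬ Function.Surjective f) :
    ∑ b : Fin n → Bool, ∏ i, coinSign (b i) * coinSign (b (f i)) = 0 := by
  -- Flipping a coin outside the range of `f` changes the sign.
  obtain ⟨j, hj⟩ := not_forall.1 hf
  have hinv : Function.Involutive fun b : Fin n → Bool => Function.update b j (!b j) := by
    intro b
    ext i
    rcases eq_or_ne i j with rfl | h
    · simp
    · simp [h]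
  have key : ∑ b : Fin n → Bool, ∏ i, coinSign (b i) * coinSign (b (f i))
      = -∑ b : Fin n → Bool, ∏ i, coinSign (b i) * coinSign (b (f i)) := by
    conv_lhs => rw [← Equiv.sum_comp hinv.toPerm]
    rw [← Finset.sum_neg_distrib]
    refine Finset.sum_congr rfl fun b _ => ?_
    have hfj : ∀ i, f i ≠ j := fun i h => hj ⟨i, h⟩
    rw [Finset.prod_mul_distrib, Finset.prod_mul_distrib, ← neg_mul]
    congr 1
    · rw [← Finset.mul_prod_erase _ _ (Finset.mem_univ j),
        ← Finset.mul_prod_erase _ (fun i => coinSign (b i)) (Finset.mem_univ j), ← neg_mul]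
      congr 1
      · simp [coinSign_not]
      · exact Finset.prod_congr rfl fun i hi => by
          simp [Function.update_of_ne (Finset.ne_of_mem_erase hi)]
    · exact Finset.prod_congr rfl fun i _ => by simp [Function.update_of_ne (hfj i)]
  exact self_eq_neg.1 key

/-- Glynn's formula: the estimator is unbiased. -/
theorem sum_glynn (A : Matrix (Fin n) (Fin n) ℂ) :
    ∑ b, glynn A b = (2 : ℂ) ^ n * A.permanent := by
  have h1 : ∀ b, glynn A b = ∑ f : Fin n → Fin n,
      (∏ i, A i (f i)) * ∏ i, coinSign (b i) * coinSign (b (f i)) := by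
    intro b
    rw [glynn, Finset.prod_mul_distrib, Finset.prod_univ_sum, Fintype.piFinset_univ,
      Finset.mul_sum]
    refine Finset.sum_congr rfl fun f _ => ?_
    simp only [Finset.prod_mul_distrib]
    ring
  simp only [h1]
  rw [Finset.sum_comm]
  simp only [← Finset.mul_sum]
  rw [← Matrix.permanent_transpose, Matrix.permanent, Finset.mul_sum]
  symm
  refine Finset.sum_of_injOn (fun σ : Equiv.Perm (Fin n) => (σ : Fin n → Fin n))
    (fun σ _ τ _ h => Equiv.coe_fn_injective h) (fun _ _ => Finset.mem_coe.2 (Finset.mem_univ _))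
    ?_ ?_
  · intro f _ hf
    rw [sum_prod_coinSign_eq_zero, mul_zero]
    intro hs
    exact hf ⟨Equiv.ofBijective f (Finite.surjective_iff_bijective.1 hs), by simp, rfl⟩
  · intro σ _
    have : ∀ b : Fin n → Bool, ∏ i, coinSign (b i) * coinSign (b (σ i)) = 1 := by
      intro b
      rw [Finset.prod_mul_distrib, Equiv.prod_comp σ fun i => coinSign (b i),
        ← Finset.prod_mul_distrib]
      exact Finset.prod_eq_one fun i _ => coinSign_mul_self _
    simp [this, mul_comm]

/-- For a contraction the estimator is bounded, by the inequality of arithmetic and geometric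
means. -/
theorem norm_glynn_le_one {A : Matrix (Fin n) (Fin n) ℂ}
    (hA : ∀ x : Fin n → ℂ, ∑ i, ‖∑ j, A i j * x j‖ ^ 2 ≤ ∑ j, ‖x j‖ ^ 2) (b : Fin n → Bool) :
    ‖glynn A b‖ ≤ 1 := by
  have h := hA fun j => coinSign (b j)
  simp only [norm_coinSign, one_pow, Finset.sum_const, Finset.card_univ, Fintype.card_fin,
    nsmul_eq_mul, mul_one] at h
  set y := fun i => ∑ j, A i j * coinSign (b j)
  have h2 : ‖glynn A b‖ ^ 2 ≤ 1 := by
    have : ‖glynn A b‖ ^ 2 = ∏ i, ‖y i‖ ^ 2 := by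
      rw [glynn, norm_prod, ← Finset.prod_pow]
      simp only [norm_mul, norm_coinSign, one_mul, y]
    rw [this]
    calc ∏ i, ‖y i‖ ^ 2 ≤ ∏ i, Real.exp (‖y i‖ ^ 2 - 1) :=
          Finset.prod_le_prod (fun i _ => by positivity) fun i _ => by
            have := Real.add_one_le_exp (‖y i‖ ^ 2 - 1)
            linarith
      _ = Real.exp (∑ i, ‖y i‖ ^ 2 - n) := by
          rw [← Real.exp_sum, Finset.sum_sub_distrib]
          simp
      _ ≤ 1 := Real.exp_le_one_iff.2 (by linarith)
  exact (sq_le_one_iff₀ (norm_nonneg _)).1 h2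

end Glynn

section SecondMoment

variable {X : Type*} [Fintype X]

theorem normSq_sum_expand (a b : ℂ) :
    ‖a + b‖ ^ 2 = ‖a‖ ^ 2 + 2 * (a * conj b).re + ‖b‖ ^ 2 := by
  rw [← Complex.normSq_eq_norm_sq, ← Complex.normSq_eq_norm_sq, ← Complex.normSq_eq_norm_sq,
    Complex.normSq_add]
  ring

/-- The second moment of a sum of independent centred random variables, uniformly distributed on
outcomes in `X`. -/
theorem sum_norm_sq_sum {g : X → ℂ} (hg : ∑ x, g x = 0) (N : ℕ) :
    (Fintype.card X : ℝ) * ∑ s : Fin N → X, ‖∑ t, g (s t)‖ ^ 2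
      = N * (Fintype.card X : ℝ) ^ N * ∑ x, ‖g x‖ ^ 2 := by
  induction N with
  | zero => simp
  | succ N ih =>
    rw [sum_fin_succ_fun]
    simp only [Fin.sum_univ_succ, Fin.cons_zero, Fin.cons_succ, normSq_sum_expand,
      Finset.sum_add_distrib]
    have hcross : ∑ x, ∑ s : Fin N → X, 2 * (g x * conj (∑ t, g (s t))).re = 0 := by
      rw [Finset.sum_comm]
      refine Finset.sum_eq_zero fun s _ => ?_
      rw [← Finset.mul_sum, ← Complex.re_sum, ← Finset.sum_mul, hg]
      simp
    rw [hcross]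
    simp only [Finset.sum_const, Finset.card_univ, nsmul_eq_mul, Fintype.card_fun,
      Fintype.card_fin, ← Finset.mul_sum]
    push_cast
    rw [add_zero, mul_add, ih]
    ring

/-- The mean square error of the average of `N` independent samples of a random variable that is
bounded by 1. -/
theorem sum_norm_sq_average_sub_le {g : X → ℂ} (hg : ∀ x, ‖g x‖ ≤ 1) {μ : ℂ}
    (hμ : ∑ x, g x = Fintype.card X * μ) {N : ℕ} (hN : 0 < N) :
    ∑ s : Fin N → X, ‖(∑ t, g (s t)) / N - μ‖ ^ 2 ≤ (Fintype.card X : ℝ) ^ N / N := by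
  rcases isEmpty_or_nonempty X with hX | hX
  · have : Nonempty (Fin N) := ⟨⟨0, hN⟩⟩
    simp only [Finset.univ_eq_empty, Finset.sum_empty]
    positivity
  have hc : (0 : ℝ) < Fintype.card X := by exact_mod_cast Fintype.card_pos
  have hN' : (0 : ℝ) < N := by exact_mod_cast hN
  have h0 : ∑ x, (g x - μ) = 0 := by
    rw [Finset.sum_sub_distrib, hμ]
    simp
  have h1 := sum_norm_sq_sum h0 N
  have h2 : ∑ x, ‖g x - μ‖ ^ 2 ≤ Fintype.card X := by
    have h3 : ∑ x, ‖g x‖ ^ 2 = ∑ x, ‖g x - μ‖ ^ 2 + Fintype.card X * ‖μ‖ ^ 2 := by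
      have : ∀ x, ‖g x‖ ^ 2 = ‖g x - μ‖ ^ 2 + 2 * ((g x - μ) * conj μ).re + ‖μ‖ ^ 2 := by
        intro x
        rw [← normSq_sum_expand, sub_add_cancel]
      simp only [this, Finset.sum_add_distrib, ← Finset.mul_sum, ← Complex.re_sum,
        ← Finset.sum_mul, h0]
      simp
    have h4 : ∑ x, ‖g x‖ ^ 2 ≤ ∑ _x : X, (1 : ℝ) :=
      Finset.sum_le_sum fun x _ => pow_le_one₀ (norm_nonneg _) (hg x)
    have h5 : (0 : ℝ) ≤ Fintype.card X * ‖μ‖ ^ 2 := by positivity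
    simp only [Finset.sum_const, Finset.card_univ, nsmul_eq_mul, mul_one] at h4
    linarith
  have h3 : ∀ s : Fin N → X,
      ‖(∑ t, g (s t)) / N - μ‖ ^ 2 = ‖∑ t, (g (s t) - μ)‖ ^ 2 / (N : ℝ) ^ 2 := by
    intro s
    have : (∑ t, g (s t)) / N - μ = (∑ t, (g (s t) - μ)) / N := by
      have : (N : ℂ) ≠ 0 := by exact_mod_cast hN.ne'
      rw [Finset.sum_sub_distrib]
      simp
      field_simp
    rw [this, norm_div, Complex.norm_natCast, div_pow]
  simp only [h3, ← Finset.sum_div]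
  rw [div_le_div_iff₀ (by positivity) hN']
  have h4 : (Fintype.card X : ℝ) * ∑ s : Fin N → X, ‖∑ t, (g (s t) - μ)‖ ^ 2
      ≤ Fintype.card X * (N * (Fintype.card X : ℝ) ^ N) := by
    rw [h1, mul_comm (Fintype.card X : ℝ)]
    gcongr
  have h5 := le_of_mul_le_mul_left h4 hc
  calc _ ≤ (N * (Fintype.card X : ℝ) ^ N) * N := by gcongr
    _ = _ := by ring

end SecondMoment

/-! ### The Fourier transform on the grid -/

section Fourier

variable {n K : ℕ} {ω : ℂ}

/-- The characters of the grid. -/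
def gridChar (ω : ℂ) (a k : Fin K → Fin (n + 1)) : ℂ := ∏ z, (ω ^ (a z : ℕ)) ^ (k z : ℕ)

theorem gridChar_comm (a k : Fin K → Fin (n + 1)) : gridChar ω a k = gridChar ω k a :=
  Finset.prod_congr rfl fun z _ => by rw [← pow_mul, ← pow_mul, mul_comm]

theorem sum_gridChar_mul_conj (hω : IsPrimitiveRoot ω (n + 1)) (a a' : Fin K → Fin (n + 1)) :
    ∑ k, gridChar ω a k * conj (gridChar ω a' k) = if a = a' then ((n : ℂ) + 1) ^ K else 0 := by
  have hnorm : ‖ω‖ = 1 := hω.norm'_eq_one (Nat.succ_ne_zero n)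
  have hconj : ∀ j : ℕ, ω ^ j * conj (ω ^ j) = 1 := by
    intro j
    rw [Complex.mul_conj, Complex.normSq_eq_norm_sq, norm_pow, hnorm]
    simp
  have hone : ∀ b b' : Fin (n + 1), ∑ k : Fin (n + 1), (ω ^ (b : ℕ)) ^ (k : ℕ) *
      conj ((ω ^ (b' : ℕ)) ^ (k : ℕ)) = if b = b' then (n : ℂ) + 1 else 0 := by
    intro b b'
    have : ∀ k : Fin (n + 1), (ω ^ (b : ℕ)) ^ (k : ℕ) * conj ((ω ^ (b' : ℕ)) ^ (k : ℕ))
        = (ω ^ (b : ℕ) * conj (ω ^ (b' : ℕ))) ^ (k : ℕ) := by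
      intro k
      rw [map_pow, mul_pow]
    simp only [this]
    rw [Fin.sum_univ_eq_sum_range fun k => (ω ^ (b : ℕ) * conj (ω ^ (b' : ℕ))) ^ k]
    split_ifs with hb
    · subst hb
      simp only [hconj, one_pow]
      simp
    · set ζ := ω ^ (b : ℕ) * conj (ω ^ (b' : ℕ)) with hζ
      have h1 : ζ ^ (n + 1) = 1 := by
        rw [hζ, mul_pow, ← map_pow, ← pow_mul, ← pow_mul, mul_comm (b : ℕ), mul_comm (b' : ℕ),
          pow_mul, pow_mul, hω.pow_eq_one]
        simp
      have h2 : ζ ≠ 1 := by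
        intro h
        apply hb
        have : ω ^ (b : ℕ) = ω ^ (b' : ℕ) := by
          calc ω ^ (b : ℕ) = ζ * ω ^ (b' : ℕ) := by
                rw [hζ, mul_assoc, mul_comm (conj _), hconj, mul_one]
            _ = _ := by rw [h, one_mul]
        exact Fin.ext (hω.pow_inj b.2 b'.2 this)
      have := mul_geom_sum ζ (n + 1)
      rw [h1, sub_self] at this
      exact (mul_eq_zero.1 this).resolve_left (sub_ne_zero.2 h2)
  calc ∑ k, gridChar ω a k * conj (gridChar ω a' k)
      = ∑ k : Fin K → Fin (n + 1), ∏ z, ((ω ^ (a z : ℕ)) ^ (k z : ℕ) *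
          conj ((ω ^ (a' z : ℕ)) ^ (k z : ℕ))) := by
        simp only [gridChar, map_prod, Finset.prod_mul_distrib]
    _ = ∏ z, ∑ j : Fin (n + 1), ((ω ^ (a z : ℕ)) ^ (j : ℕ) *
          conj ((ω ^ (a' z : ℕ)) ^ (j : ℕ))) := by
        rw [Finset.prod_univ_sum, Fintype.piFinset_univ]
    _ = _ := by
        simp only [hone]
        split_ifs with h
        · subst h
          simp
        · obtain ⟨z, hz⟩ := Function.ne_iff.1 h
          exact Finset.prod_eq_zero (Finset.mem_univ z) (if_neg hz)

/-- The inverse Fourier transform on the grid. -/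
def gridInv (ω : ℂ) (X : (Fin K → Fin (n + 1)) → ℂ) (k : Fin K → Fin (n + 1)) : ℂ :=
  (∑ a, X a * conj (gridChar ω a k)) / ((n : ℂ) + 1) ^ K

theorem gridInv_sum (hω : IsPrimitiveRoot ω (n + 1)) (P : (Fin K → Fin (n + 1)) → ℂ)
    (k : Fin K → Fin (n + 1)) : gridInv ω (fun a => ∑ k, P k * gridChar ω a k) k = P k := by
  have hM : ((n : ℂ) + 1) ^ K ≠ 0 := pow_ne_zero _ (by exact_mod_cast Nat.succ_ne_zero n)
  rw [gridInv, div_eq_iff hM]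
  simp only [Finset.sum_mul]
  rw [Finset.sum_comm]
  have : ∀ k', ∑ a, P k' * gridChar ω a k' * conj (gridChar ω a k)
      = P k' * if k' = k then ((n : ℂ) + 1) ^ K else 0 := by
    intro k'
    rw [← sum_gridChar_mul_conj hω, Finset.mul_sum]
    refine Finset.sum_congr rfl fun a _ => ?_
    rw [gridChar_comm a k', gridChar_comm a k, mul_assoc]
  simp [this]

/-- Parseval's identity on the grid. -/
theorem sum_norm_sq_gridInv (hω : IsPrimitiveRoot ω (n + 1)) (Y : (Fin K → Fin (n + 1)) → ℂ) :
    ((n : ℝ) + 1) ^ K * ∑ k, ‖gridInv ω Y k‖ ^ 2 = ∑ a, ‖Y a‖ ^ 2 := by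
  have hsq : ∀ z : ℂ, ((‖z‖ ^ 2 : ℝ) : ℂ) = z * conj z := fun z => by
    rw [Complex.mul_conj, Complex.normSq_eq_norm_sq]
  have hM : ((n : ℂ) + 1) ^ K ≠ 0 := pow_ne_zero _ (by exact_mod_cast Nat.succ_ne_zero n)
  rw [← Complex.ofReal_inj, Complex.ofReal_mul, Complex.ofReal_sum, Complex.ofReal_sum]
  simp only [hsq, gridInv]
  push_cast
  have hMc : conj (((n : ℂ) + 1) ^ K) = ((n : ℂ) + 1) ^ K := by simp
  simp only [map_div₀, hMc, map_sum, map_mul, Complex.conj_conj, div_mul_div_comm,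
    Finset.sum_mul_sum]
  rw [← Finset.sum_div, Finset.sum_comm]
  have : ∀ a, ∑ k, ∑ a', Y a * conj (gridChar ω a k) * (conj (Y a') * gridChar ω a' k)
      = ((n : ℂ) + 1) ^ K * (Y a * conj (Y a)) := by
    intro a
    rw [Finset.sum_comm]
    have h1 : ∀ a', ∑ k, Y a * conj (gridChar ω a k) * (conj (Y a') * gridChar ω a' k)
        = Y a * conj (Y a') * if a' = a then ((n : ℂ) + 1) ^ K else 0 := by
      intro a'
      rw [← sum_gridChar_mul_conj hω, Finset.mul_sum]
      exact Finset.sum_congr rfl fun k _ => by ring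
    simp only [h1, mul_ite, mul_zero, Finset.sum_ite_eq', Finset.mem_univ, if_true]
    ring
  rw [Finset.sum_congr rfl fun a _ => this a, ← Finset.mul_sum]
  field_simp

/-- The inverse Fourier transform is a contraction from `ℓ²` to `ℓ¹`, by the Cauchy–Schwarz
inequality. -/
theorem sum_norm_gridInv_le (hω : IsPrimitiveRoot ω (n + 1)) (Y : (Fin K → Fin (n + 1)) → ℂ) :
    (∑ k, ‖gridInv ω Y k‖) ^ 2 ≤ ∑ a, ‖Y a‖ ^ 2 := by
  rw [← sum_norm_sq_gridInv hω]
  have := sq_sum_le_card_mul_sum_sq (s := (Finset.univ : Finset (Fin K → Fin (n + 1))))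
    (f := fun k => ‖gridInv ω Y k‖)
  simpa using this

theorem gridInv_sub (X Y : (Fin K → Fin (n + 1)) → ℂ) (k : Fin K → Fin (n + 1)) :
    gridInv ω (fun a => X a - Y a) k = gridInv ω X k - gridInv ω Y k := by
  simp only [gridInv, sub_mul, Finset.sum_sub_distrib, sub_div]

end Fourier

/-! ### Success probability -/

section Probability

variable {n K : ℕ}

/-- The coins, arranged in blocks of length `n`. -/
def coinBlocks (n N : ℕ) (coin : ℕ → Bool) (t : Fin N) (i : Fin n) : Bool := coin (n * t + i)

theorem measurable_coinBlocks (n N : ℕ) : Measurable (coinBlocks n N) := by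
  unfold coinBlocks
  fun_prop

instance isProbabilityMeasure_coinLaw : IsProbabilityMeasure coinLaw := by
  unfold coinLaw
  infer_instance

theorem coinLaw_preimage_singleton {N : ℕ} (hn : 0 < n) (s : Fin N → Fin n → Bool) :
    coinLaw (coinBlocks n N ⁻¹' {s}) = 2⁻¹ ^ (n * N) := by
  have hdiv : ∀ q < n * N, q / n < N := fun q hq => Nat.div_lt_of_lt_mul hq
  have : coinBlocks n N ⁻¹' {s} = Set.pi (Finset.range (n * N) : Set ℕ)
      fun q => if h : q < n * N then {s ⟨q / n, hdiv q h⟩ ⟨q % n, Nat.mod_lt _ hn⟩} else ∅ := by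
    ext coin
    simp only [Set.mem_preimage, Set.mem_singleton_iff, Set.mem_pi, Finset.coe_range, Set.mem_Iio]
    constructor
    · rintro rfl q hq
      simp [hq, coinBlocks, Nat.div_add_mod]
    · intro h
      ext t i
      have hq : n * t + i < n * N := by
        calc n * t + i < n * (t + 1) := by rw [mul_add]; omega
          _ ≤ n * N := Nat.mul_le_mul_left _ t.2
      have h1 : (n * t + i : ℕ) / n = t := by
        rw [Nat.mul_add_div hn, Nat.div_eq_of_lt i.2, add_zero]
      have h2 : (n * t + i : ℕ) % n = i := by
        rw [Nat.mul_add_mod, Nat.mod_eq_of_lt i.2]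
      have := h _ hq
      simpa [hq, h1, h2, coinBlocks] using this
  rw [this, coinLaw, Measure.infinitePi_pi]
  · rw [Finset.prod_congr rfl (g := fun _ => 2⁻¹), Finset.prod_const, Finset.card_range]
    intro q hq
    rw [dif_pos (Finset.mem_range.1 hq), PMF.toMeasure_uniformOfFintype_apply _
      (measurableSet_singleton _)]
    simp
  · intro q _
    exact MeasurableSet.of_discrete

theorem coinLaw_preimage {N : ℕ} (hn : 0 < n) (B : Finset (Fin N → Fin n → Bool)) :
    coinLaw (coinBlocks n N ⁻¹' B) = B.card * 2⁻¹ ^ (n * N) := by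
  rw [← Measure.map_apply (measurable_coinBlocks n N) B.measurableSet, ← sum_measure_singleton,
    Finset.sum_congr rfl fun s _ => by
      rw [Measure.map_apply (measurable_coinBlocks n N) (measurableSet_singleton _),
        coinLaw_preimage_singleton hn s]]
  simp

/-- Markov's inequality, for a nonnegative function of the coins. -/
theorem one_sub_le_coinLaw {N : ℕ} (hn : 0 < n) {f : (Fin N → Fin n → Bool) → ℝ}
    (hf : ∀ s, 0 ≤ f s) {ε δ : ℝ} (hε : 0 < ε) (hδ : 0 ≤ δ)
    (hsum : ∑ s, f s ≤ δ * ε * 2 ^ (n * N)) :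
    ENNReal.ofReal (1 - δ) ≤ coinLaw {coin | f (coinBlocks n N coin) ≤ ε} := by
  classical
  set B : Finset (Fin N → Fin n → Bool) := Finset.univ.filter fun s => ε < f s with hB
  have hcard : (B.card : ℝ) ≤ δ * 2 ^ (n * N) := by
    have : B.card * ε ≤ δ * ε * 2 ^ (n * N) := by
      calc (B.card : ℝ) * ε = ∑ s ∈ B, ε := by simp
        _ ≤ ∑ s ∈ B, f s := Finset.sum_le_sum fun s hs => (Finset.mem_filter.1 hs).2.le
        _ ≤ ∑ s, f s := Finset.sum_le_univ_sum_of_nonneg hf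
        _ ≤ _ := hsum
    nlinarith
  have hbad : coinLaw (coinBlocks n N ⁻¹' B) ≤ ENNReal.ofReal δ := by
    rw [coinLaw_preimage hn, ← ENNReal.ofReal_natCast]
    have h2 : (2⁻¹ : ENNReal) ^ (n * N) = ENNReal.ofReal ((2 ^ (n * N))⁻¹) := by
      rw [ENNReal.ofReal_inv_of_pos (by positivity), ENNReal.ofReal_pow (by norm_num),
        ENNReal.inv_pow]
      simp
    rw [h2, ← ENNReal.ofReal_mul (by positivity)]
    apply ENNReal.ofReal_le_ofReal
    rw [← div_eq_mul_inv, div_le_iff₀ (by positivity)]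
    exact hcard
  have hcompl : {coin | f (coinBlocks n N coin) ≤ ε} = (coinBlocks n N ⁻¹' B)ᶜ := by
    ext coin
    simp [hB]
  rw [hcompl, prob_compl_eq_one_sub (measurable_coinBlocks n N B.measurableSet),
    ENNReal.ofReal_sub _ hδ, ENNReal.ofReal_one]
  exact tsub_le_tsub_left hbad 1

end Probability

section Success

variable {n K : ℕ}

theorem address_eq (k : Fin K → Fin (n + 1)) : address k = (finFunctionFinEquiv k : ℕ) :=
  (finFunctionFinEquiv_apply k).symm

theorem address_lt (k : Fin K → Fin (n + 1)) : address k < (n + 1) ^ K := by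
  rw [address_eq]
  exact (finFunctionFinEquiv k).2

theorem digit_address (k : Fin K → Fin (n + 1)) (z : Fin K) : digit n (address k) z = k z := by
  conv_rhs => rw [← finFunctionFinEquiv.symm_apply_apply k]
  rw [address_eq]
  rfl

theorem fourier_address (ω : ℂ) (X : ℕ → ℂ) (k : Fin K → Fin (n + 1)) :
    fourier n K ω X (address k) = gridInv ω (fun a => X (address a)) k := by
  rw [fourier, gridInv, Finset.sum_range, ← Equiv.sum_comp finFunctionFinEquiv]
  push_cast
  congr 1
  refine Finset.sum_congr rfl fun a _ => ?_
  rw [← address_eq, gridChar, map_prod, Finset.prod_range]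
  congr 1
  refine Finset.prod_congr rfl fun z _ => ?_
  simp only [digit_address, map_pow]

variable {E ι : Type*} [NormedAddCommGroup E] [InnerProductSpace ℂ E] [Fintype ι] {m : ℕ}
  {h : n ≤ m} {U : Matrix (Fin m) (Fin m) ℂ} {φ : Fin n → E} {Φ : ι → E}

/-- The matrix of the characteristic function at a grid point. -/
abbrev gridMatrix (h : n ≤ m) (U : Matrix (Fin m) (Fin m) ℂ) (φ : Fin n → E) (Φ : ι → E)
    (𝒦 : Fin K → Finset (Fin m)) (ω : ℂ) (a : Fin K → Fin (n + 1)) : Matrix (Fin n) (Fin n) ℂ :=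
  charMatrix h U φ Φ 𝒦 fun z => ω ^ (a z : ℕ)

theorem table_apply {a b : ℕ} (A : Matrix (Fin a) (Fin b) ℂ) (i : Fin a) (j : Fin b) :
    table A i j = A i j := by
  simp [table]

/-- The machine's estimate at a grid point is the average of Glynn's estimators. -/
theorem estimate_address (hU : U ∈ Matrix.unitaryGroup (Fin m) ℂ)
    (hφ : ∀ j, ‖φ j‖ = 1) (hΦ : Orthonormal ℂ Φ)
    (hΦφ : ∀ j, ∑ a, ‖inner ℂ (Φ a) (φ j)‖ ^ 2 = 1) {𝒦 : Fin K → Finset (Fin m)}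
    (h𝒦 : Pairwise fun z z' => Disjoint (𝒦 z) (𝒦 z')) (N : ℕ) (coin : ℕ → Bool) (ω : ℂ)
    (a : Fin K → Fin (n + 1)) :
    estimate n K N (fun q => coinSign (coin q)) (overlap (opticsInput U 𝒦) m) (table (gram φ)) ω
      (address a) = (∑ t, glynn (gridMatrix h U φ Φ 𝒦 ω a) (coinBlocks n N coin t)) / N := by
  rw [estimate, Finset.sum_range]
  congr 1
  refine Finset.sum_congr rfl fun t _ => ?_
  rw [glynn, Finset.prod_range]
  refine Finset.prod_congr rfl fun i _ => ?_
  change coinSign (coinBlocks n N coin t i) * _ = _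
  congr 1
  simp only [gridMatrix, charMatrix_apply hU hφ hΦ hΦφ h𝒦, add_mul, Finset.sum_add_distrib]
  congr 1
  · simp [coinBlocks]
  · rw [Finset.sum_range]
    refine Finset.sum_congr rfl fun j _ => ?_
    change coinSign (coinBlocks n N coin t j) * _ * _ = _
    rw [table_apply, mul_assoc, mul_comm]
    congr 2
    rw [Finset.sum_range]
    refine Finset.sum_congr rfl fun z _ => ?_
    rw [digit_address, overlap, Finset.sum_range]
    congr 1
    refine Finset.sum_congr rfl fun k _ => ?_
    simp only [opticsInput, table_apply, Matrix.of_apply]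
    rw [← table_apply U (Fin.castLE h i), ← table_apply U (Fin.castLE h j)]
    rfl

/-- The mean square error of the estimates, summed over the grid. -/
theorem sum_sum_norm_sq_le (hU : U ∈ Matrix.unitaryGroup (Fin m) ℂ)
    (hφ : ∀ j, ‖φ j‖ = 1) (hΦ : Orthonormal ℂ Φ)
    (hΦφ : ∀ j, ∑ a, ‖inner ℂ (Φ a) (φ j)‖ ^ 2 = 1) (𝒦 : Fin K → Finset (Fin m))
    {N : ℕ} (hN : 0 < N) {ω : ℂ} (hω : ‖ω‖ = 1) :
    ∑ s : Fin N → Fin n → Bool, ∑ a : Fin K → Fin (n + 1),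
      ‖(∑ t, glynn (gridMatrix h U φ Φ 𝒦 ω a) (s t)) / N - (gridMatrix h U φ Φ 𝒦 ω a).permanent‖ ^ 2
      ≤ ((n : ℝ) + 1) ^ K * (2 ^ (n * N) / N) := by
  rw [Finset.sum_comm]
  have : ∀ a : Fin K → Fin (n + 1), ∑ s : Fin N → Fin n → Bool,
      ‖(∑ t, glynn (gridMatrix h U φ Φ 𝒦 ω a) (s t)) / N - (gridMatrix h U φ Φ 𝒦 ω a).permanent‖ ^ 2
      ≤ 2 ^ (n * N) / N := by
    intro a
    refine (sum_norm_sq_average_sub_le (norm_glynn_le_one fun x =>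
      sum_norm_sq_charMatrix_le hU hφ hΦ hΦφ 𝒦 (fun z => by simp [hω]) x) ?_ hN).trans_eq ?_
    · rw [sum_glynn]
      simp
    · simp [pow_mul]
  refine (Finset.sum_le_sum fun a _ => this a).trans_eq ?_
  simp

theorem outputWithin_of_sum_le {s : Config} {X : ℕ → ℂ} {ω : ℂ}
    (hω : IsPrimitiveRoot ω (n + 1)) {β : ℝ} (hβ : 0 ≤ β)
    (hs : ∀ b < (n + 1) ^ K, s.arr 0 b = ((fourier n K ω X b).re : ℂ))
    {𝒦 : Fin K → Finset (Fin m)} (hX : ∑ a : Fin K → Fin (n + 1),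
      ‖X (address a) - (gridMatrix h U φ Φ 𝒦 ω a).permanent‖ ^ 2 ≤ β ^ 2) :
    OutputWithin n s (binnedProb h U φ Φ 𝒦) β := by
  refine ⟨fun k => (fourier n K ω X (address k)).re, fun k => hs _ (address_lt k), ?_⟩
  set P : (Fin K → Fin (n + 1)) → ℂ := fun k => (binnedProb h U φ Φ 𝒦 fun z => (k z : ℕ)) with hP
  have hperm : ∀ a, (gridMatrix h U φ Φ 𝒦 ω a).permanent = ∑ k, P k * gridChar ω a k :=
    fun a => (sum_binnedProb_mul_prod_pow h U φ Φ 𝒦 _).symm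
  simp only [hperm] at hX
  have h1 := (sum_norm_gridInv_le hω _).trans hX
  refine le_trans (Finset.sum_le_sum fun k _ => ?_) (abs_le_of_sq_le_sq' h1 hβ).2
  rw [gridInv_sub, gridInv_sum hω, ← fourier_address]
  refine le_trans (le_of_eq ?_) (Complex.abs_re_le_norm _)
  simp [hP]

end Success

/-! ### Running time -/

theorem prepTime_le {n m : ℕ} (K : ℕ) (hn : 1 ≤ n) (hm : n ≤ m) :
    3 + n * (5 + n * (5 + K * (22 * m + 2 * n + 2 * K + 27)))
      ≤ (13 + K * (51 + 2 * K)) * (m * n ^ 2) := by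
  have h1 : 1 ≤ m := hn.trans hm
  calc 3 + n * (5 + n * (5 + K * (22 * m + 2 * n + 2 * K + 27)))
      = 3 * (1 * 1 * 1) + n * (5 * (1 * 1)
          + n * (5 * 1 + K * (22 * m + 2 * n + 2 * K * 1 + 27 * 1))) := by ring
    _ ≤ 3 * (m * n * n) + n * (5 * (m * n)
          + n * (5 * m + K * (22 * m + 2 * m + 2 * K * m + 27 * m))) := by gcongr
    _ = _ := by ring

/-- A constant for the running time of the main phase with `K` bins. -/
def mainConst (K : ℕ) : ℕ := 300 + 300 * K + 100 * K ^ 2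

theorem mainTime_le {n M N : ℕ} (K : ℕ) (hn : 1 ≤ n) (hM : 1 ≤ M) :
    mainTime n K M N ≤ mainConst K * (n ^ 2 * M * (M + N)) := by
  have hn2 : 1 ≤ n ^ 2 := Nat.one_le_pow _ _ hn
  have hn2' : n ≤ n ^ 2 := Nat.le_self_pow two_ne_zero n
  have p : n ^ 2 * M * (M + N) = n ^ 2 * M * M + n ^ 2 * M * N := by ring
  have a0 : 1 * 1 * 1 ≤ n ^ 2 * M * M := by gcongr
  have a1 : 1 * 1 * M ≤ n ^ 2 * M * M := by gcongr
  have a2 : 1 * M * M ≤ n ^ 2 * M * M := by gcongr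
  have a3 : n * 1 * M ≤ n ^ 2 * M * M := by gcongr
  have a4 : n * M * M ≤ n ^ 2 * M * M := by gcongr
  have b0 : 1 * 1 * N ≤ n ^ 2 * M * N := by gcongr
  have b1 : 1 * M * N ≤ n ^ 2 * M * N := by gcongr
  have b2 : n * 1 * N ≤ n ^ 2 * M * N := by gcongr
  have b3 : n * M * N ≤ n ^ 2 * M * N := by gcongr
  have k := fun {a b : ℕ} (h : a ≤ b) => Nat.mul_le_mul_left K h
  have k2 := fun {a b : ℕ} (h : a ≤ b) => Nat.mul_le_mul_left (K ^ 2) h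
  rw [p, mainConst, mainTime]
  have z1 := Nat.zero_le (K * (n ^ 2 * M * N))
  have z2 := Nat.zero_le (K ^ 2 * (n ^ 2 * M * N))
  have z3 := Nat.zero_le (K * (n ^ 2 * M * M))
  have z4 := Nat.zero_le (K ^ 2 * (n ^ 2 * M * M))
  linarith [k a0, k a1, k a2, k a3, k a4, k b0, k b1, k b2, k b3, k2 a1, k2 a2, k2 a3, k2 a4]

/-! ### The loss model -/

theorem mem_unitaryGroup_fromBlocks {m : ℕ} {W : Matrix (Fin m) (Fin m) ℂ}
    (hW : W ∈ Matrix.unitaryGroup (Fin m) ℂ) :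
    Matrix.fromBlocks W 0 0 1 ∈ Matrix.unitaryGroup (Fin m ⊕ Fin m) ℂ := by
  rw [Matrix.mem_unitaryGroup_iff, Matrix.star_eq_conjTranspose] at *
  rw [Matrix.fromBlocks_conjTranspose, Matrix.fromBlocks_multiply]
  simp [hW]

theorem lossyUnitary_mem_unitaryGroup {m : ℕ} {W₁ W₂ : Matrix (Fin m) (Fin m) ℂ}
    (hW₁ : W₁ ∈ Matrix.unitaryGroup (Fin m) ℂ) (hW₂ : W₂ ∈ Matrix.unitaryGroup (Fin m) ℂ)
    {lam : Fin m → ℝ} (hlam : ∀ i, 0 ≤ lam i ∧ lam i ≤ 1) :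
    lossyUnitary W₁ W₂ lam ∈ Matrix.unitaryGroup (Fin (m + m)) ℂ := by
  have hreindex : ∀ A ∈ Matrix.unitaryGroup (Fin m ⊕ Fin m) ℂ,
      Matrix.reindex finSumFinEquiv finSumFinEquiv A ∈ Matrix.unitaryGroup (Fin (m + m)) ℂ := by
    intro A hA
    rw [Matrix.mem_unitaryGroup_iff, Matrix.star_eq_conjTranspose] at *
    rw [Matrix.conjTranspose_reindex, Matrix.reindex_apply, Matrix.reindex_apply,
      Matrix.submatrix_mul_equiv, hA, Matrix.submatrix_one_equiv]
  refine hreindex _ (mul_mem (mul_mem (mem_unitaryGroup_fromBlocks hW₁) ?_)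
    (mem_unitaryGroup_fromBlocks hW₂))
  have ht : ∀ i, ((Real.sqrt (lam i) : ℝ) : ℂ) * (Real.sqrt (lam i) : ℝ) = lam i := fun i => by
    rw [← Complex.ofReal_mul, Real.mul_self_sqrt (hlam i).1]
  have hr : ∀ i, ((Real.sqrt (1 - lam i) : ℝ) : ℂ) * (Real.sqrt (1 - lam i) : ℝ) = 1 - lam i :=
    fun i => by
      rw [← Complex.ofReal_mul, Real.mul_self_sqrt (by linarith [(hlam i).2])]
      simp
  have hstar : ∀ x : Fin m → ℝ, star (fun i => ((Real.sqrt (x i) : ℝ) : ℂ))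
      = fun i => ((Real.sqrt (x i) : ℝ) : ℂ) := fun x => by
    ext i
    simp
  rw [Matrix.mem_unitaryGroup_iff, Matrix.star_eq_conjTranspose, Matrix.fromBlocks_conjTranspose,
    Matrix.fromBlocks_multiply, Matrix.conjTranspose_neg]
  simp only [Matrix.diagonal_conjTranspose, hstar, Matrix.diagonal_mul_diagonal, neg_mul, mul_neg,
    neg_neg, Matrix.diagonal_add, ht, hr]
  rw [← Matrix.fromBlocks_one]
  congr 1 <;> ext i j <;> rcases eq_or_ne i j with rfl | hij <;> simp [*, mul_comm]

/-! ### The algorithm meets its specification -/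

theorem isPrimitiveRoot_root (n : ℕ) :
    IsPrimitiveRoot (Complex.exp (2 * Real.pi * Complex.I / (n + 1))) (n + 1) := by
  exact_mod_cast Complex.isPrimitiveRoot_exp (n + 1) (Nat.succ_ne_zero n)

/-- The bound on the running time of the main phase, in terms of the accuracy: with `M` grid points
there are about `c * M * β⁻²` samples, and `M ≤ 2 ^ K * n ^ K`. The logarithm is needed only as a
factor bounded away from zero. -/
theorem mainTime_le_of_accuracy {n K c N : ℕ} {β : ℝ} (hn : 2 ≤ n) (hβ : 0 < β) (hβ1 : β ≤ 1)
    (hN : (N : ℝ) ≤ c * ((n + 1) ^ K : ℕ) * β ^ (-2 : ℤ) + 1) :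
    (mainTime n K ((n + 1) ^ K) N : ℝ) ≤ (mainConst K * 4 ^ K * (c + 2) / Real.log 2)
      * (n ^ (2 * K + 2) * Real.log n * β ^ (-2 : ℤ)) := by
  have hM : 1 ≤ (n + 1) ^ K := Nat.one_le_pow _ _ (Nat.succ_pos n)
  have h1 : (mainTime n K ((n + 1) ^ K) N : ℝ)
      ≤ mainConst K * (n ^ 2 * ((n + 1) ^ K : ℕ) * (((n + 1) ^ K : ℕ) + N)) := by
    exact_mod_cast mainTime_le (N := N) K (by omega : 1 ≤ n) hM
  have h2 : (((n + 1) ^ K : ℕ) : ℝ) ≤ 2 ^ K * n ^ K := by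
    rw [← mul_pow]
    exact_mod_cast Nat.pow_le_pow_left (by omega : n + 1 ≤ 2 * n) K
  have hM' : (1 : ℝ) ≤ ((n + 1) ^ K : ℕ) := by exact_mod_cast hM
  generalize (n + 1) ^ K = M at *
  set b := β ^ (-2 : ℤ) with hb
  have hb1 : 1 ≤ b := by
    rw [hb, zpow_neg, one_le_inv₀ (by positivity)]
    exact pow_le_one₀ hβ.le hβ1
  have h3 : (M : ℝ) + N ≤ (c + 2) * M * b := by
    have h4 : (M : ℝ) * 1 ≤ M * b := by gcongr
    have h5 : (1 : ℝ) * 1 ≤ M * b := by gcongr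
    linarith
  have hlog2 : 0 < Real.log 2 := Real.log_pos one_lt_two
  have hlog : Real.log 2 ≤ Real.log n := Real.log_le_log two_pos (by exact_mod_cast hn)
  have h4 : 1 ≤ Real.log n / Real.log 2 := (one_le_div hlog2).2 hlog
  calc (mainTime n K M N : ℝ) ≤ mainConst K * (n ^ 2 * M * (M + N)) := h1
    _ ≤ mainConst K * (n ^ 2 * M * ((c + 2) * M * b)) := by gcongr
    _ ≤ mainConst K * (n ^ 2 * (2 ^ K * n ^ K) * ((c + 2) * (2 ^ K * n ^ K) * b)) := by gcongr
    _ = mainConst K * 4 ^ K * (c + 2) * (n ^ (2 * K + 2) * b) * 1 := by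
      rw [show (4 : ℝ) ^ K = 2 ^ K * 2 ^ K by rw [← mul_pow]; norm_num]
      ring
    _ ≤ mainConst K * 4 ^ K * (c + 2) * (n ^ (2 * K + 2) * b) * (Real.log n / Real.log 2) := by
      gcongr
    _ = _ := by ring

/-- The two phases stay within their time bounds and succeed with probability at least `1 - δ`. -/
theorem algorithm_spec {K c : ℕ} {δ : ℝ} (hδ : 0 < δ) (hc : 1 ≤ c * δ) {n m : ℕ} (hn : 2 ≤ n)
    (h : n ≤ m) {U : Matrix (Fin m) (Fin m) ℂ} (hU : U ∈ Matrix.unitaryGroup (Fin m) ℂ)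
    {𝒦 : Fin K → Finset (Fin m)} (h𝒦 : Pairwise fun z z' => Disjoint (𝒦 z) (𝒦 z'))
    {E : Type u} [NormedAddCommGroup E] [InnerProductSpace ℂ E]
    {φ : Fin n → E} (hφ : ∀ j, ‖φ j‖ = 1) {ι : Type v} [Fintype ι] {Φ : ι → E}
    (hΦ : Orthonormal ℂ Φ) (hΦφ : ∀ j, ∑ a, ‖inner ℂ (Φ a) (φ j)‖ ^ 2 = 1)
    {β : ℝ} (hβ : 0 < β) (hβ1 : β ≤ 1) :
    (∀ coin, ((afterPrep n (prepProg K) U 𝒦 coin).time : ℝ)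
        ≤ (13 + K * (51 + 2 * K) : ℕ) * (m * n ^ 2) ∧
      ((afterMain (prepProg K) (mainProg K c) U 𝒦 (gram φ) β coin).time : ℝ)
        ≤ (afterPrep n (prepProg K) U 𝒦 coin).time
          + (mainConst K * 4 ^ K * (c + 2) / Real.log 2)
            * (n ^ (2 * K + 2) * Real.log n * β ^ (-2 : ℤ))) ∧
    ENNReal.ofReal (1 - δ) ≤ coinLaw {coin |
      OutputWithin n (afterMain (prepProg K) (mainProg K c) U 𝒦 (gram φ) β coin)
        (binnedProb h U φ Φ 𝒦) β} := by
  set M := (n + 1) ^ K with hM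
  set ω : ℂ := Complex.exp (2 * Real.pi * Complex.I / (n + 1)) with hω
  set N := ⌈c * (M : ℝ) * β ^ (-2 : ℤ)⌉₊ with hN
  have hroot : modelInput (gram φ) β .root 0 0 = ω :=
    table_apply (Matrix.of fun _ _ : Fin 1 => ω) 0 0
  have hacc : modelInput (gram φ) β .accuracy 0 0 = (β : ℂ) :=
    table_apply (Matrix.of fun _ _ : Fin 1 => (β : ℂ)) 0 0
  have hceil : ⌈((c : ℂ) * (M : ℕ) / (modelInput (gram φ) β .accuracy 0 0 *
      modelInput (gram φ) β .accuracy 0 0)).re⌉₊ = N := by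
    have : (c : ℂ) * (M : ℕ) / ((β : ℂ) * β) = ((c * (M : ℝ) * β ^ (-2 : ℤ) : ℝ) : ℂ) := by
      rw [zpow_neg]
      push_cast
      rw [div_eq_mul_inv]
      norm_cast
      rw [sq]
    rw [hacc, this, Complex.ofReal_re]
  have hM1 : (1 : ℝ) ≤ M := by exact_mod_cast Nat.one_le_pow _ _ (Nat.succ_pos n)
  have hc0 : 0 < (c : ℝ) := by
    by_contra hneg
    have : (c : ℝ) * δ ≤ 0 := mul_nonpos_of_nonpos_of_nonneg (not_lt.1 hneg) hδ.le
    linarith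
  have hNpos : 0 < N := Nat.ceil_pos.2 (by positivity)
  have prep := fun coin => prepProg_spec K (opticsInput U 𝒦) coin n m
  have main := fun coin => mainProg_spec K c n (modelInput (gram φ) β) coin
    (afterPrep n (prepProg K) U 𝒦 coin) (prep coin).1 (prep coin).2.1 _ (prep coin).2.2.1 N hceil
  refine ⟨fun coin => ⟨?_, ?_⟩, ?_⟩
  · exact_mod_cast ((prep coin).2.2.2.trans (prepTime_le K (by omega) h))
  · have h1 : ((afterMain (prepProg K) (mainProg K c) U 𝒦 (gram φ) β coin).time : ℝ)
        ≤ (afterPrep n (prepProg K) U 𝒦 coin).time + mainTime n K M N := by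
      exact_mod_cast (main coin).2
    have h2 := mainTime_le_of_accuracy (K := K) (c := c) (N := N) hn hβ hβ1
      (Nat.ceil_lt_add_one (by positivity)).le
    linarith
  · have hn0 : 0 < n := by omega
    have hω1 : ‖ω‖ = 1 := (isPrimitiveRoot_root n).norm'_eq_one (Nat.succ_ne_zero n)
    have hsum := sum_sum_norm_sq_le (h := h) hU hφ hΦ hΦφ 𝒦 hNpos hω1
    refine (one_sub_le_coinLaw hn0 (fun s => ?_) (by positivity : 0 < β ^ 2) hδ.le
      (hsum.trans ?_)).trans (measure_mono fun coin hcoin => ?_)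
    · exact Finset.sum_nonneg fun a _ => sq_nonneg _
    · -- The number of samples is chosen such that `M / N ≤ δ * β ^ 2`.
      have hN' : c * (M : ℝ) * β ^ (-2 : ℤ) ≤ N := Nat.le_ceil _
      have hMN : (M : ℝ) ≤ δ * β ^ 2 * N := by
        calc (M : ℝ) ≤ (c * δ) * M := le_mul_of_one_le_left (by positivity) hc
          _ = δ * β ^ 2 * (c * (M : ℝ) * β ^ (-2 : ℤ)) := by
            rw [zpow_neg, zpow_ofNat]
            field_simp
          _ ≤ _ := by gcongr
      have hN0 : (0 : ℝ) < N := by exact_mod_cast hNpos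
      rw [mul_div_assoc', div_le_iff₀ hN0]
      have : ((n : ℝ) + 1) ^ K = M := by rw [hM]; push_cast; ring
      rw [this]
      calc (M : ℝ) * 2 ^ (n * N) ≤ δ * β ^ 2 * N * 2 ^ (n * N) := by gcongr
        _ = _ := by ring
    · refine outputWithin_of_sum_le (X := estimate n K N (fun q => coinSign (coin q))
        (overlap (opticsInput U 𝒦) m) (table (gram φ)) ω) (isPrimitiveRoot_root n) hβ.le
        (fun b hb => ?_) (le_trans (le_of_eq ?_) hcoin)
      · have := (main coin).1 b hb
        rw [hroot] at this
        exact this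
      · exact Finset.sum_congr rfl fun a _ => by
          rw [estimate_address (h := h) hU hφ hΦ hΦφ h𝒦]

end BosonSampling

end

theorem theorem1 (K : ℕ) (δ : ℝ) (hδ : 0 < δ) :
    ∃ (C : ℝ) (prep main : Prog),
      -- `n` partially distinguishable photons in an interferometer with `m` modes
      (∀ (n m : ℕ) (_ : 2 ≤ n) (h : n ≤ m)
        (U : Matrix (Fin m) (Fin m) ℂ) (_ : U ∈ Matrix.unitaryGroup (Fin m) ℂ)
        (𝒦 : Fin K → Finset (Fin m)) (_ : Pairwise fun z z' => Disjoint (𝒦 z) (𝒦 z'))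
        (E : Type u) [NormedAddCommGroup E] [InnerProductSpace ℂ E]
        (φ : Fin n → E) (_ : ∀ j, ‖φ j‖ = 1)
        (ι : Type v) [Fintype ι] (Φ : ι → E) (_ : Orthonormal ℂ Φ)
        (_ : ∀ j, ∑ a, ‖inner ℂ (Φ a) (φ j)‖ ^ 2 = 1)
        (β : ℝ) (_ : 0 < β) (_ : β ≤ 1),
        (∀ coin,
          ((afterPrep n prep U 𝒦 coin).time : ℝ) ≤ C * (m * n ^ 2) ∧
          ((afterMain prep main U 𝒦 (gram φ) β coin).time : ℝ)
            ≤ (afterPrep n prep U 𝒦 coin).time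
              + C * (n ^ (2 * K + 2) * Real.log n * β ^ (-2 : ℤ))) ∧
        ENNReal.ofReal (1 - δ) ≤ coinLaw {coin |
          OutputWithin n (afterMain prep main U 𝒦 (gram φ) β coin)
            (binnedProb h U φ Φ 𝒦) β}) ∧
      -- the same with loss: `m` measured modes and `m` environment modes
      (∀ (n m : ℕ) (_ : 2 ≤ n) (h : n ≤ m)
        (W₁ W₂ : Matrix (Fin m) (Fin m) ℂ) (_ : W₁ ∈ Matrix.unitaryGroup (Fin m) ℂ)
        (_ : W₂ ∈ Matrix.unitaryGroup (Fin m) ℂ)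
        (lam : Fin m → ℝ) (_ : ∀ i, 0 ≤ lam i ∧ lam i ≤ 1)
        (𝒦 : Fin K → Finset (Fin m)) (_ : Pairwise fun z z' => Disjoint (𝒦 z) (𝒦 z'))
        (E : Type u) [NormedAddCommGroup E] [InnerProductSpace ℂ E]
        (φ : Fin n → E) (_ : ∀ j, ‖φ j‖ = 1)
        (ι : Type v) [Fintype ι] (Φ : ι → E) (_ : Orthonormal ℂ Φ)
        (_ : ∀ j, ∑ a, ‖inner ℂ (Φ a) (φ j)‖ ^ 2 = 1)
        (β : ℝ) (_ : 0 < β) (_ : β ≤ 1),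
        let Ul : Matrix (Fin (m + m)) (Fin (m + m)) ℂ := lossyUnitary W₁ W₂ lam
        let 𝒦l : Fin K → Finset (Fin (m + m)) := fun z => (𝒦 z).map (Fin.castAddEmb m)
        (∀ coin,
          ((afterPrep n prep Ul 𝒦l coin).time : ℝ) ≤ C * (m * n ^ 2) ∧
          ((afterMain prep main Ul 𝒦l (gram φ) β coin).time : ℝ)
            ≤ (afterPrep n prep Ul 𝒦l coin).time
              + C * (n ^ (2 * K + 2) * Real.log n * β ^ (-2 : ℤ))) ∧
        ENNReal.ofReal (1 - δ) ≤ coinLaw {coin |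
          OutputWithin n (afterMain prep main Ul 𝒦l (gram φ) β coin)
            (binnedProb (h.trans (Nat.le_add_right m m)) Ul φ Φ 𝒦l) β}) := by
  obtain ⟨c, hc⟩ := exists_nat_ge (1 / δ)
  rw [div_le_iff₀ hδ] at hc
  set C₁ : ℝ := ((13 + K * (51 + 2 * K) : ℕ) : ℝ)
  set C₂ : ℝ := mainConst K * 4 ^ K * (c + 2) / Real.log 2
  have hC₁ : 0 ≤ C₁ := Nat.cast_nonneg _
  have hC₂ : 0 ≤ C₂ := div_nonneg (by positivity) (Real.log_nonneg one_le_two)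
  have hmain : ∀ (n : ℕ) (β : ℝ), 2 ≤ n → C₂ * (n ^ (2 * K + 2) * Real.log n * β ^ (-2 : ℤ))
      ≤ (2 * C₁ + C₂) * (n ^ (2 * K + 2) * Real.log n * β ^ (-2 : ℤ)) := by
    intro n β hn
    have : 0 ≤ Real.log n := Real.log_nonneg (by exact_mod_cast (by omega : 1 ≤ n))
    have : 0 ≤ β ^ (-2 : ℤ) := by rw [zpow_neg]; positivity
    gcongr
    linarith
  refine ⟨2 * C₁ + C₂, prepProg K, mainProg K c, ?_, ?_⟩
  · intro n m hn h U hU 𝒦 h𝒦 E _ _ φ hφ ι _ Φ hΦ hΦφ β hβ hβ1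
    obtain ⟨ht, hp⟩ := algorithm_spec hδ hc hn h hU h𝒦 hφ hΦ hΦφ hβ hβ1
    refine ⟨fun coin => ⟨(ht coin).1.trans ?_, (ht coin).2.trans ?_⟩, hp⟩
    · gcongr
      linarith
    · exact add_le_add le_rfl (hmain n β hn)
  · intro n m hn h W₁ W₂ hW₁ hW₂ lam hlam 𝒦 h𝒦 E _ _ φ hφ ι _ Φ hΦ hΦφ β hβ hβ1 Ul 𝒦l
    have h𝒦l : Pairwise fun z z' => Disjoint (𝒦l z) (𝒦l z') := fun z z' hz =>
      (Finset.disjoint_map _).2 (h𝒦 hz)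
    obtain ⟨ht, hp⟩ := algorithm_spec hδ hc hn (h.trans (Nat.le_add_right m m))
      (lossyUnitary_mem_unitaryGroup hW₁ hW₂ hlam) h𝒦l hφ hΦ hΦφ hβ hβ1
    refine ⟨fun coin => ⟨(ht coin).1.trans ?_, (ht coin).2.trans ?_⟩, hp⟩
    · -- The factor 2 accounts for the environment modes.
      have : (0 : ℝ) ≤ C₂ * (m * n ^ 2) := by positivity
      change C₁ * (((m + m : ℕ) : ℝ) * n ^ 2) ≤ _
      rw [Nat.cast_add]
      linarith
    · exact add_le_add le_rfl (hmain n β hn)
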